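/- Let $(X,H,\mu)$ be an abstract Wiener space: $X$ is a real separable Banach space, $\mu$ is a centered Gaussian measure on $X$, and $H\hookrightarrow X$ is its Cameron--Martin space, a real Hilbert space. Let $S:H\to H$ be a bounded linear operator with $SS^*=I$, and write $S_n:=S^n$. Denote by $\hat S:X\to X$ its (a.e. unique) measure-preserving extension: a Borel measurable map which, on some Borel linear subspace $E\supseteq H$ of $X$ with $\mu(E)=1$, is linear and which satisfies $\hat S|_H=S$. Let $A:=\bigcap_{n\ge 0}\operatorname{Im}(S_n^*)\subseteq H$ be the unitary part of $S$. For $x\in A$, let $\mu_x$ be the spectral measure of $S$ at $x$: the finite Borel measure on the unit circle $\mathbb T\subset\mathbb C$ with $\int_{\mathbb T} z^k\,\mu_x(dz)=\langle S_kx,x\rangle_H$ for all $k\in\mathbb Z$, where $S_{k}:=S_{-k}^*$ for $k<0$. Then: 1. The tail $\sigma$-algebra $\bigcap_{n\ge 1}\sigma(\hat S^n)$ consists only of sets of $\mu$-measure $0$ or $1$ if and only if $\|S_nx\|_H\to 0$ as $n\to\infty$ for all $x\in H$. 2. $\hat S$ is strongly mixing, i.e. $\mu$ is $\hat S$-invariant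 and $\mu(\hat S^{-n}B\cap C)\to\mu(B)\mu(C)$ for all Borel $B,C\subseteq X$, if and only if $\langle S_nx,y\rangle_H\to 0$ as $n\to\infty$ for all $x,y\in H$. 3. $\hat S$ is ergodic if and only if any of the following five equivalent conditions holds: (a) $\frac1n\sum_{j=1}^n\langle S_jx,y\rangle_H^k\to 0$ as $n\to\infty$ for all $x,y\in H$ and all integers $k\ge 1$; (b) $\frac1n\sum_{j=1}^n|\langle S_jx,y\rangle_H|\to 0$ as $n\to\infty$ for all $x,y\in H$; (c) $\hat S$ is weakly mixing, i.e. $\mu$ is $\hat S$-invariant and $\frac1n\sum_{j=1}^n|\mu(\hat S^{-j}B\cap C)-\mu(B)\mu(C)|\to 0$ for all Borel $B,C\subseteq X$; (d) $S$ admits no invariant two-dimensional subspace on which it acts by a rotation matrix (in some orthonormal basis), and no one-dimensional subspace on which it acts by $1$ or by $-1$; (e) for every $x\in A$ the spectral measure $\mu_x$ is atomless. -/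

import Mathlib

open MeasureTheory ProbabilityTheory Filter Topology

/-- `(X, H, μ)`, with the embedding `ι : H → X`, is an abstract Wiener space: `μ` is a centered
Gaussian measure on `X`, and `ι` identifies the Hilbert space `H` with the Cameron-Martin space of
`μ`. The latter says that `ι` is injective and that the covariance of `μ` is `ι ∘ ι*`: the variance
of `ℓ ∈ X*` is the squared norm of `ℓ ∘ ι ∈ H*`. (As `μ` is Gaussian, this is equivalent to
`∫ exp (i ℓ) dμ = exp (- ‖ℓ ∘ ι‖² / 2)`; the embedding is then automatically compact.) -/
structure IsAbstractWienerSpace {X H : Type*} [NormedAddCommGroup X] [NormedSpace ℝ X]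
    [MeasurableSpace X] [BorelSpace X] [NormedAddCommGroup H] [InnerProductSpace ℝ H]
    (ι : H →L[ℝ] X) (μ : Measure X) : Prop where
  isGaussian : IsGaussian μ
  centered : ∀ ℓ : X →L[ℝ] ℝ, ∫ x, ℓ x ∂μ = 0
  injective : Function.Injective ι
  covariance : ∀ ℓ : X →L[ℝ] ℝ, ∫ x, (ℓ x) ^ 2 ∂μ = ‖ℓ.comp ι‖ ^ 2

/-- `T : X → X` is a Borel measurable, almost everywhere linear extension of `S : H → H`: it is
linear on a Borel linear subspace `E ⊇ H` of full measure, and it restricts to `S` on `H`. Such a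
`T` exists and is unique up to a.e. equality when `S` is bounded. Its values off `E`
are arbitrary. -/
structure IsAELinearExtension {X H : Type*} [NormedAddCommGroup X] [NormedSpace ℝ X]
    [MeasurableSpace X] [NormedAddCommGroup H] [InnerProductSpace ℝ H]
    (ι : H →L[ℝ] X) (μ : Measure X) (S : H →L[ℝ] H) (T : X → X) : Prop where
  measurable : Measurable T
  linear_extends : ∃ E : Submodule ℝ X, MeasurableSet (E : Set X) ∧ (∀ᵐ x ∂μ, x ∈ E) ∧
    (∃ L : E →ₗ[ℝ] X, ∀ x : E, T x = L x) ∧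
    ∀ h : H, ι h ∈ E ∧ T (ι h) = ι (S h)

/-- The tail σ-algebra `⋂_{n ≥ 1} σ(T^n)` of a map `T`. -/
@[reducible]
def tailSigmaAlgebra {X : Type*} [m : MeasurableSpace X] (T : X → X) : MeasurableSpace X :=
  ⨅ n : ℕ, ⨅ _ : 1 ≤ n, MeasurableSpace.comap (T^[n]) m

/-- The σ-algebra `m'` consists only of sets of `μ`-measure zero or one. -/
def IsZeroOneSigmaAlgebra {X : Type*} [MeasurableSpace X] (μ : Measure X)
    (m' : MeasurableSpace X) : Prop :=
  ∀ s : Set X, MeasurableSet[m'] s → μ s = 0 ∨ μ s = 1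

/-- A measure-preserving map `T` is strongly mixing if `μ(T⁻ⁿ A ∩ B) → μ(A) μ(B)`. -/
structure StronglyMixing {X : Type*} [MeasurableSpace X] (T : X → X) (μ : Measure X) : Prop
    extends MeasurePreserving T μ μ where
  mixing : ∀ A B : Set X, MeasurableSet A → MeasurableSet B →
    Tendsto (fun n : ℕ => μ.real (T^[n] ⁻¹' A ∩ B)) atTop (𝓝 (μ.real A * μ.real B))

/-- A measure-preserving map `T` is weakly mixing if the Cesàro means of
`|μ(T⁻ʲ A ∩ B) - μ(A) μ(B)|` tend to zero. -/
structure WeaklyMixing {X : Type*} [MeasurableSpace X] (T : X → X) (μ : Measure X) : Prop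
    extends MeasurePreserving T μ μ where
  mixing : ∀ A B : Set X, MeasurableSet A → MeasurableSet B →
    Tendsto (fun n : ℕ => (1 / (n : ℝ)) * ∑ j ∈ Finset.Icc 1 n,
      |μ.real (T^[j] ⁻¹' A ∩ B) - μ.real A * μ.real B|) atTop (𝓝 0)

/-- The unit circle carries its Borel σ-algebra. -/
noncomputable instance instMeasurableSpaceCircle : MeasurableSpace Circle := borel Circle

instance instBorelSpaceCircle : BorelSpace Circle := ⟨rfl⟩

section Operator

variable {H : Type*} [NormedAddCommGroup H] [InnerProductSpace ℝ H]

/-- `M` is a two-dimensional subspace, invariant under `S`, on which `S` acts by a rotation matrix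
(with respect to some orthonormal basis of `M`). -/
def IsRotationPlane (S : H →L[ℝ] H) (M : Submodule ℝ H) : Prop :=
  ∃ (b : OrthonormalBasis (Fin 2) ℝ M) (θ : ℝ),
    S (b 0) = Real.cos θ • (b 0 : H) + Real.sin θ • (b 1 : H) ∧
    S (b 1) = -Real.sin θ • (b 0 : H) + Real.cos θ • (b 1 : H)

/-- `M` is a one-dimensional subspace on which `S` acts by `1` or by `-1` (the orthogonal matrices
of size one). -/
def IsOrthogonalLine (S : H →L[ℝ] H) (M : Submodule ℝ H) : Prop :=
  Module.finrank ℝ M = 1 ∧ ((∀ x ∈ M, S x = x) ∨ (∀ x ∈ M, S x = -x))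

variable [CompleteSpace H]

/-- The unitary part `⋂_n Im((Sⁿ)*)` of `S`. -/
noncomputable def unitaryPart (S : H →L[ℝ] H) : Submodule ℝ H :=
  ⨅ n : ℕ, (ContinuousLinearMap.adjoint (S ^ n)).range

/-- `S_k` for an integer `k`: `Sᵏ` if `k ≥ 0`, and `(S^{-k})*` if `k < 0`. -/
noncomputable def intPow (S : H →L[ℝ] H) (k : ℤ) : H →L[ℝ] H :=
  if 0 ≤ k then S ^ k.toNat else ContinuousLinearMap.adjoint (S ^ (-k).toNat)

/-- `ν` is the spectral measure of `S` at `x`: the (unique) finite Borel measure on the unit circle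
whose Fourier coefficients are `⟨S_k x, x⟩`, `k ∈ ℤ`. -/
structure IsSpectralMeasure (S : H →L[ℝ] H) (x : H) (ν : Measure Circle) : Prop where
  isFiniteMeasure : IsFiniteMeasure ν
  fourier : ∀ k : ℤ, ∫ z : Circle, (z : ℂ) ^ k ∂ν = ((inner ℝ (intPow S k x) x : ℝ) : ℂ)

end Operator

/-! Everything is transported from $L^2(\mu)$ to $H$. The Wiener integral $W : H \to L^2(\mu)$
(`wienerMap`) extends $\iota^*\ell \mapsto \ell$ isometrically, and composition with `T` acts on it
by $Wh \circ T = W S^* h$. The crux is `dual_comp_ae_eq`: $\ell \circ T - W(S^*\iota^*\ell)$ is odd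
and invariant under shifts by $\iota(H)$ on a set of full measure, and a shift-invariant function is
independent of every functional, hence a.e. constant. In particular `T` preserves $\mu$, because
$S^*$ is isometric.

The exponential vectors $E(h) = \exp(Wh - \|h\|^2/2)$ are total in $L^2(\mu)$, satisfy $\langle
E(h), E(k)\rangle = e^{\langle h,k\rangle}$, and are moved by `T` to $E(S^*h)$. Their centred
correlations are $e^{\langle S^j k, h\rangle} - 1$. So for any notion of null sequence stable under
linear combinations and uniform limits (`IsNullNotion`), mixing of `T` amounts to nullity of these
numbers (`isNull_measureReal_iff`). Ordinary convergence gives part 2, Cesàro nullity gives weak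
mixing. Ergodicity enters through the mean ergodic theorem: the averages of $e^{\langle S^j
x,y\rangle}$ tend to 1, and adding the same for $-x$ bounds the averages of $\langle S^j
x,y\rangle^2$.

The spectral conditions come from the measure with Fourier coefficients $\langle S^j x,x\rangle$
(Herglotz, by compactness of the Fejér measures) and from Wiener's lemma. An atom at $e^{i\theta}$
is detected by the averages of $e^{-ij\theta}\langle S^jx,x\rangle$, whose limit is governed by a
fixed vector of $e^{-i\theta}\otimes S$ on the complexification; the real and imaginary parts of
such a vector give a rotation plane or an eigenline. Conversely, such a plane or line lies in the
unitary part and carries correlations that do not decay.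

For the tail, $U^n{}^*E(k) = E(S^nk)$ tends to $E(0) = 1$ when $S^nk \to 0$ ($U$ being composition
with `T`), which forces tail indicators to be constant. Conversely, for $x$ in the unitary part,
$\{Wx > 0\}$ is a.e. a tail event, so symmetry of the Gaussian forces $x = 0$; and a coisometry
without unitary part satisfies $S^n x \to 0$. -/

set_option linter.unusedSectionVars false

/-! ### Cesàro means and null sequences -/

/-- The Cesàro mean `n⁻¹ (c 1 + ⋯ + c n)`. -/
noncomputable def cesaroMean {E : Type*} [AddCommGroup E] [Module ℝ E] (c : ℕ → E) (n : ℕ) : E :=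
  (1 / (n : ℝ)) • ∑ j ∈ Finset.Icc 1 n, c j

section CesaroMean

variable {E F : Type*} [NormedAddCommGroup E] [NormedSpace ℝ E]
  [NormedAddCommGroup F] [NormedSpace ℝ F]

lemma cesaroMean_add (c d : ℕ → E) (n : ℕ) :
    cesaroMean (fun j => c j + d j) n = cesaroMean c n + cesaroMean d n := by
  simp [cesaroMean, Finset.sum_add_distrib, smul_add]

lemma cesaroMean_const_mul (a : ℝ) (c : ℕ → ℝ) (n : ℕ) :
    cesaroMean (fun j => a * c j) n = a * cesaroMean c n := by
  simp only [cesaroMean, ← Finset.mul_sum, smul_eq_mul]; ring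

lemma cesaroMean_const (a : ℝ) {n : ℕ} (hn : n ≠ 0) : cesaroMean (fun _ => a) n = a := by
  have : (n : ℝ) ≠ 0 := by exact_mod_cast hn
  simp [cesaroMean]; field_simp

lemma cesaroMean_mono {c d : ℕ → ℝ} (h : ∀ j, c j ≤ d j) (n : ℕ) :
    cesaroMean c n ≤ cesaroMean d n := by
  simp only [cesaroMean, smul_eq_mul]
  exact mul_le_mul_of_nonneg_left (Finset.sum_le_sum fun j _ => h j) (by positivity)

lemma cesaroMean_nonneg {c : ℕ → ℝ} (h : ∀ j, 0 ≤ c j) (n : ℕ) : 0 ≤ cesaroMean c n := by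
  simp only [cesaroMean, smul_eq_mul]
  exact mul_nonneg (by positivity) (Finset.sum_nonneg fun j _ => h j)

lemma norm_cesaroMean_le (c : ℕ → E) (n : ℕ) :
    ‖cesaroMean c n‖ ≤ cesaroMean (fun j => ‖c j‖) n := by
  simp only [cesaroMean, norm_smul, smul_eq_mul]
  rw [Real.norm_of_nonneg (by positivity)]
  exact mul_le_mul_of_nonneg_left (norm_sum_le _ _) (by positivity)

lemma cesaroMean_const_le {a : ℝ} (ha : 0 ≤ a) (n : ℕ) : cesaroMean (fun _ => a) n ≤ a := by
  rcases eq_or_ne n 0 with rfl | hn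
  · simpa [cesaroMean] using ha
  · rw [cesaroMean_const a hn]

lemma norm_cesaroMean_le_of_bounded {c : ℕ → E} {C : ℝ} (h : ∀ j, ‖c j‖ ≤ C) (n : ℕ) :
    ‖cesaroMean c n‖ ≤ C :=
  (norm_cesaroMean_le c n).trans <| (cesaroMean_mono h n).trans <|
    cesaroMean_const_le ((norm_nonneg _).trans (h 0)) n

lemma map_cesaroMean (φ : E →L[ℝ] F) (c : ℕ → E) (n : ℕ) :
    φ (cesaroMean c n) = cesaroMean (fun j => φ (c j)) n := by
  simp [cesaroMean]

lemma sq_cesaroMean_le (c : ℕ → ℝ) (n : ℕ) :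
    cesaroMean c n ^ 2 ≤ cesaroMean (fun j => c j ^ 2) n := by
  rcases eq_or_ne n 0 with rfl | hn
  · simp [cesaroMean]
  have hn' : (0 : ℝ) < n := by positivity
  have := sq_sum_le_card_mul_sum_sq (s := Finset.Icc 1 n) (f := c)
  simp only [Nat.card_Icc, Nat.add_sub_cancel] at this
  simp only [cesaroMean, smul_eq_mul, mul_pow]
  calc (1 / (n : ℝ)) ^ 2 * (∑ i ∈ Finset.Icc 1 n, c i) ^ 2
      ≤ (1 / (n : ℝ)) ^ 2 * (n * ∑ i ∈ Finset.Icc 1 n, c i ^ 2) := by gcongr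
    _ = _ := by field_simp

omit [NormedSpace ℝ E] in
lemma sum_Icc_one_eq_sum_range (c : ℕ → E) (n : ℕ) :
    ∑ j ∈ Finset.Icc 1 n, c j = ∑ j ∈ Finset.range n, c (j + 1) := by
  rw [Finset.range_eq_Ico, Finset.sum_Ico_add' c 0 n 1]
  rfl

end CesaroMean

/-- The sequence `c` tends to zero in the strong Cesàro sense. -/
def CesaroNull (c : ℕ → ℝ) : Prop :=
  Tendsto (cesaroMean fun j => |c j|) atTop (𝓝 0)

lemma CesaroNull.of_le {c d : ℕ → ℝ} (hd : CesaroNull d) (C : ℝ) (h : ∀ j, |c j| ≤ C * |d j|) :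
    CesaroNull c := by
  refine squeeze_zero (fun n => cesaroMean_nonneg (fun j => abs_nonneg _) n)
    (fun n => cesaroMean_mono h n) ?_
  refine Tendsto.congr (fun n => (cesaroMean_const_mul C _ n).symm) ?_
  simpa using hd.const_mul C

lemma CesaroNull.tendsto_cesaroMean {c : ℕ → ℝ} (hc : CesaroNull c) :
    Tendsto (cesaroMean c) atTop (𝓝 0) :=
  squeeze_zero_norm (fun n => norm_cesaroMean_le c n) hc

/-- Cauchy–Schwarz for the averages. All proofs of Cesàro nullity that start from an $L^2$ argument
end here. -/
lemma cesaroNull_of_sq {c : ℕ → ℝ} (h : Tendsto (cesaroMean fun j => c j ^ 2) atTop (𝓝 0)) :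
    CesaroNull c := by
  have h2 : Tendsto (fun n => √(cesaroMean (fun j => c j ^ 2) n)) atTop (𝓝 0) := by
    simpa using h.sqrt
  refine squeeze_zero (fun n => cesaroMean_nonneg (fun j => abs_nonneg _) n) (fun n => ?_) h2
  apply Real.le_sqrt_of_sq_le
  simpa using sq_cesaroMean_le (fun j => |c j|) n

lemma CesaroNull.of_shift {c : ℕ → ℝ} (m : ℕ) (h : CesaroNull fun j => c (j + m)) :
    CesaroNull c := by
  induction m with
  | zero => simpa using h
  | succ m ih =>
    apply ih
    set d : ℕ → ℝ := fun j => c (j + m)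
    have hd : CesaroNull fun j => d (j + 1) := by
      simpa [d, add_assoc, add_comm, add_left_comm] using h
    -- Passing to the shifted sum loses only the term $|d_1|$, which the factor $1/n$ kills.
    have h1 : Tendsto (fun n : ℕ => (1 / (n : ℝ)) * |d 1| + cesaroMean (fun j => |d (j + 1)|) n)
        atTop (𝓝 0) := by
      simpa using (tendsto_one_div_atTop_nhds_zero_nat.mul_const |d 1|).add hd
    refine squeeze_zero (fun n => cesaroMean_nonneg (fun j => abs_nonneg _) n) (fun n => ?_) h1
    simp only [cesaroMean, smul_eq_mul, ← mul_add]
    refine mul_le_mul_of_nonneg_left ?_ (by positivity)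
    rw [sum_Icc_one_eq_sum_range, sum_Icc_one_eq_sum_range (fun j => |d (j + 1)|)]
    cases n with
    | zero => simp
    | succ n =>
      rw [Finset.sum_range_succ', Finset.sum_range_succ]
      have : 0 ≤ |d (n + 1 + 1)| := abs_nonneg _
      simp only [zero_add]; linarith

/-- A notion of null sequence: closed under linear combinations and uniform limits. -/
structure IsNullNotion (N : (ℕ → ℝ) → Prop) : Prop where
  zero : N 0
  add : ∀ {c d}, N c → N d → N (fun j => c j + d j)
  const_mul : ∀ {c} (a : ℝ), N c → N (fun j => a * c j)
  uniform : ∀ {c}, (∀ δ > 0, ∃ d, N d ∧ ∀ j, |c j - d j| ≤ δ) → N c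

lemma isNullNotion_cesaroNull : IsNullNotion CesaroNull where
  zero := by
    refine Tendsto.congr (f₁ := fun _ => 0) (fun n => ?_) tendsto_const_nhds
    simp [cesaroMean]
  add {c d} hc hd := by
    refine squeeze_zero (fun n => cesaroMean_nonneg (fun j => abs_nonneg _) n)
      (fun n => cesaroMean_mono (fun j => abs_add_le (c j) (d j)) n) ?_
    refine Tendsto.congr (fun n => (cesaroMean_add _ _ n).symm) ?_
    simpa using Tendsto.add hc hd
  const_mul a hc := hc.of_le |a| fun j => by rw [abs_mul]
  uniform {c} h := by
    rw [CesaroNull, Metric.tendsto_atTop]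
    intro δ hδ
    obtain ⟨d, hd, hcd⟩ := h (δ / 2) (by positivity)
    obtain ⟨n₀, hn₀⟩ := Metric.tendsto_atTop.1 hd (δ / 2) (by positivity)
    refine ⟨n₀, fun n hn => ?_⟩
    have h1 := hn₀ n hn
    rw [Real.dist_0_eq_abs] at h1 ⊢
    rw [abs_of_nonneg (cesaroMean_nonneg (fun j => abs_nonneg _) n)] at h1 ⊢
    calc cesaroMean (fun j => |c j|) n ≤ cesaroMean (fun j => |d j| + δ / 2) n := by
          refine cesaroMean_mono (fun j => ?_) n
          have := abs_add_le (c j - d j) (d j)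
          rw [sub_add_cancel] at this
          linarith [hcd j]
      _ ≤ cesaroMean (fun j => |d j|) n + δ / 2 := by
          rw [cesaroMean_add]
          linarith [cesaroMean_const_le (by positivity : 0 ≤ δ / 2) n]
      _ < δ := by linarith

lemma isNullNotion_tendsto : IsNullNotion fun c => Tendsto c atTop (𝓝 0) where
  zero := tendsto_const_nhds
  add hc hd := by simpa using hc.add hd
  const_mul a hc := by simpa using hc.const_mul a
  uniform {c} h := by
    rw [Metric.tendsto_atTop]
    intro δ hδ
    obtain ⟨d, hd, hcd⟩ := h (δ / 2) (by positivity)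
    obtain ⟨n₀, hn₀⟩ := Metric.tendsto_atTop.1 hd (δ / 2) (by positivity)
    refine ⟨n₀, fun n hn => ?_⟩
    have h1 := hn₀ n hn
    rw [Real.dist_0_eq_abs] at h1 ⊢
    have := abs_add_le (c n - d n) (d n)
    rw [sub_add_cancel] at this
    linarith [hcd n]

section Density

variable {E F : Type*} [NormedAddCommGroup E] [NormedSpace ℝ E]
  [NormedAddCommGroup F] [NormedSpace ℝ F]

lemma IsNullNotion.of_dense {N : (ℕ → ℝ) → Prop} (hN : IsNullNotion N) (φ : ℕ → E →L[ℝ] ℝ)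
    {C : ℝ} (hφ : ∀ j, ‖φ j‖ ≤ C) {s : Set E} (hs : Dense (Submodule.span ℝ s : Set E))
    (h : ∀ f ∈ s, N fun j => φ j f) (f : E) : N fun j => φ j f := by
  have hspan : ∀ f ∈ Submodule.span ℝ s, N fun j => φ j f := by
    intro f hf
    induction hf using Submodule.span_induction with
    | mem x hx => exact h x hx
    | zero => simpa using! hN.zero
    | add x y _ _ hx hy => simpa using hN.add hx hy
    | smul a x _ hx => simpa using hN.const_mul a hx
  have hC : 0 ≤ C := (norm_nonneg _).trans (hφ 0)
  refine hN.uniform fun δ hδ => ?_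
  -- The denominator is `C + 1` because `C` may be zero.
  obtain ⟨g, hg, hfg⟩ := Metric.dense_iff.1 hs f (δ / (C + 1)) (by positivity)
  refine ⟨_, hspan g hfg, fun j => ?_⟩
  rw [← map_sub, ← Real.norm_eq_abs]
  have hgf : ‖f - g‖ ≤ δ / (C + 1) := by
    rw [← dist_eq_norm, dist_comm]; exact (Metric.mem_ball.1 hg).le
  calc ‖φ j (f - g)‖ ≤ ‖φ j‖ * ‖f - g‖ := (φ j).le_opNorm _
    _ ≤ C * (δ / (C + 1)) := by gcongr; exact hφ j
    _ ≤ (C + 1) * (δ / (C + 1)) := by gcongr; linarith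
    _ = δ := by field_simp

lemma IsNullNotion.of_dense₂ {N : (ℕ → ℝ) → Prop} (hN : IsNullNotion N)
    (B : ℕ → E →L[ℝ] F →L[ℝ] ℝ) {C : ℝ} (hB : ∀ j, ‖B j‖ ≤ C) {s : Set E} {t : Set F}
    (hs : Dense (Submodule.span ℝ s : Set E)) (ht : Dense (Submodule.span ℝ t : Set F))
    (h : ∀ f ∈ s, ∀ g ∈ t, N fun j => B j f g) (f : E) (g : F) : N fun j => B j f g := by
  have h1 : ∀ f ∈ s, ∀ g, N fun j => B j f g := fun f hf =>
    hN.of_dense (fun j => B j f) (C := C * ‖f‖)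
      (fun j => ((B j).le_opNorm f).trans (by gcongr; exact hB j)) ht (h f hf)
  exact hN.of_dense (fun j => (B j).flip g) (C := C * ‖g‖)
    (fun j => ((B j).flip.le_opNorm g).trans (by
      rw [ContinuousLinearMap.opNorm_flip]; gcongr; exact hB j)) hs
    (fun f hf => h1 f hf g) f

end Density

/-! ### Correlations under powers of an isometry -/

section Isometry

variable {H : Type*} [NormedAddCommGroup H] [InnerProductSpace ℝ H]

lemma norm_pow_apply {V : H →L[ℝ] H} (hV : ∀ x, ‖V x‖ = ‖x‖) (n : ℕ) (x : H) :
    ‖(V ^ n) x‖ = ‖x‖ := by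
  induction n with
  | zero => simp
  | succ n ih => rw [pow_succ', mul_apply_eq_comp, hV, ih]

lemma inner_map_map_of_norm {V : H →L[ℝ] H} (hV : ∀ x, ‖V x‖ = ‖x‖) (x y : H) :
    inner ℝ (V x) (V y) = inner ℝ x y := by
  rw [real_inner_eq_norm_add_mul_self_sub_norm_mul_self_sub_norm_mul_self_div_two,
    real_inner_eq_norm_add_mul_self_sub_norm_mul_self_sub_norm_mul_self_div_two, ← map_add]
  simp only [hV]

lemma inner_pow_add_pow {V : H →L[ℝ] H} (hV : ∀ x, ‖V x‖ = ‖x‖) (j m : ℕ) (x y : H) :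
    inner ℝ ((V ^ (j + m)) x) ((V ^ m) y) = inner ℝ ((V ^ j) x) y := by
  rw [add_comm, pow_add, mul_apply_eq_comp]
  exact inner_map_map_of_norm (norm_pow_apply hV m) _ _

variable [CompleteSpace H]

/-- If the correlations of `x` with itself are null in the Cesàro sense, so are the correlations
of `x` with every other vector. -/
lemma cesaroNull_inner_of_self {V : H →L[ℝ] H} (hV : ∀ x, ‖V x‖ = ‖x‖) {x : H}
    (h : CesaroNull fun j => inner ℝ ((V ^ j) x) x) (y : H) :
    CesaroNull fun j => inner ℝ ((V ^ j) x) y := by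
  let M : Submodule ℝ H := Submodule.span ℝ (Set.range fun m : ℕ => (V ^ m) x)
  have hM : ∀ m, (V ^ m) x ∈ M := fun m => Submodule.subset_span ⟨m, rfl⟩
  -- The orbit of `x` together with its orthogonal complement is total. On an orbit vector the
  -- correlations are a shift of the self-correlations; on the complement they vanish.
  refine isNullNotion_cesaroNull.of_dense (fun j => innerSL ℝ ((V ^ j) x)) (C := ‖x‖)
    (fun j => by rw [innerSL_apply_norm, norm_pow_apply hV])
    (s := Set.range (fun m : ℕ => (V ^ m) x) ∪ (Mᗮ : Set H)) ?_ ?_ y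
  · rw [Submodule.dense_iff_topologicalClosure_eq_top, Submodule.topologicalClosure_eq_top_iff,
      Submodule.eq_bot_iff]
    intro z hz
    have hzM : z ∈ Mᗮ := Submodule.orthogonal_le (Submodule.span_mono Set.subset_union_left) hz
    have := Submodule.inner_right_of_mem_orthogonal
      (Submodule.subset_span (Or.inr hzM) : z ∈ Submodule.span ℝ _) hz
    exact inner_self_eq_zero.1 this
  · rintro f (⟨m, rfl⟩ | hf)
    · apply CesaroNull.of_shift m
      simpa only [innerSL_apply_apply, inner_pow_add_pow hV] using h
    · have : (fun j => innerSL ℝ ((V ^ j) x) f) = 0 := by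
        ext j
        exact Submodule.inner_right_of_mem_orthogonal (hM j) hf
      rw [this]
      exact isNullNotion_cesaroNull.zero

end Isometry

/-! ### Fourier coefficients and atoms of measures on the circle -/

/-- Away from $u = 1$ the geometric sums are bounded by $2/|u-1|$, so dividing by $n$ gives zero. -/
lemma Complex.tendsto_cesaroMean_pow {u : ℂ} (hu : ‖u‖ = 1) :
    Tendsto (cesaroMean fun j => u ^ j) atTop (𝓝 (if u = 1 then 1 else 0)) := by
  split_ifs with h
  · subst h
    refine Tendsto.congr' ?_ (tendsto_const_nhds (x := (1 : ℂ)))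
    filter_upwards [eventually_ne_atTop 0] with n hn
    have : (n : ℂ) ≠ 0 := by exact_mod_cast hn
    simp [cesaroMean, this]
  · have hu1 : u - 1 ≠ 0 := sub_ne_zero.2 h
    have h0 : Tendsto (fun n : ℕ => (1 / (n : ℝ)) * (2 / ‖u - 1‖)) atTop (𝓝 0) := by
      simpa using tendsto_one_div_atTop_nhds_zero_nat.mul_const (2 / ‖u - 1‖)
    refine squeeze_zero_norm (fun n => ?_) h0
    rw [cesaroMean, norm_smul, Real.norm_of_nonneg (by positivity), sum_Icc_one_eq_sum_range]
    refine mul_le_mul_of_nonneg_left ?_ (by positivity)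
    simp_rw [pow_succ', ← Finset.mul_sum]
    rw [geom_sum_eq h, norm_mul, hu, one_mul, norm_div]
    gcongr
    calc ‖u ^ n - 1‖ ≤ ‖u ^ n‖ + ‖(1 : ℂ)‖ := norm_sub_le _ _
      _ = 2 := by rw [norm_pow, hu]; norm_num

section Circle

variable {ν : Measure Circle} [IsFiniteMeasure ν]

lemma integrable_circle_of_continuous {f : Circle → ℂ} (hf : Continuous f) : Integrable f ν :=
  hf.integrable_of_hasCompactSupport (HasCompactSupport.of_compactSpace f)

lemma integral_cesaroMean {α : Type*} [MeasurableSpace α] {m : Measure α} {f : ℕ → α → ℂ}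
    (hf : ∀ j, Integrable (f j) m) (n : ℕ) :
    ∫ z, cesaroMean (fun j => f j z) n ∂m = cesaroMean (fun j => ∫ z, f j z ∂m) n := by
  simp only [cesaroMean]
  rw [integral_smul, integral_finsetSum _ fun j _ => hf j]

/-- The averages of $(z/w)^j$ are bounded by 1 and converge pointwise to the indicator of $\{w\}$;
dominated convergence recovers the mass of the atom. -/
lemma tendsto_cesaroMean_integral_atom (w : Circle) :
    Tendsto (cesaroMean fun j => ((w : ℂ) ^ j)⁻¹ * ∫ z : Circle, (z : ℂ) ^ j ∂ν) atTop
      (𝓝 (ν.real {w} : ℂ)) := by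
  have hcont : ∀ j : ℕ, Continuous fun z : Circle => ((z : ℂ) / w) ^ j := fun j => by fun_prop
  have key : Tendsto (fun n => ∫ z : Circle, cesaroMean (fun j => ((z : ℂ) / w) ^ j) n ∂ν) atTop
      (𝓝 (∫ z : Circle, Set.indicator {w} (fun _ => (1 : ℂ)) z ∂ν)) := by
    refine tendsto_integral_of_dominated_convergence (fun _ => 1) (fun n => ?_)
      (integrable_const _) (fun n => .of_forall fun z => ?_) (.of_forall fun z => ?_)
    · refine Continuous.aestronglyMeasurable ?_
      exact (continuous_finsetSum _ fun j _ => hcont j).const_smul _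
    · exact norm_cesaroMean_le_of_bounded (fun j => by simp [Circle.norm_coe]) n
    · convert Complex.tendsto_cesaroMean_pow (u := (z : ℂ) / w)
        (by simp [Circle.norm_coe]) using 2
      rcases eq_or_ne z w with rfl | h
      · simp
      · have h' : (z : ℂ) ≠ w := fun h' => h (Circle.ext h')
        rw [if_neg (by rwa [div_eq_one_iff_eq w.coe_ne_zero]),
          Set.indicator_of_notMem (by simpa using h)]
  rw [integral_indicator (measurableSet_singleton w)] at key
  simp only [integral_const, MeasurableSet.univ, measureReal_restrict_apply, Set.univ_inter,
    Complex.real_smul, mul_one] at key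
  refine key.congr fun n => ?_
  rw [integral_cesaroMean fun j => integrable_circle_of_continuous (hcont j)]
  congr 1
  ext j
  rw [← integral_const_mul]
  congr 1
  ext z
  rw [div_pow, div_eq_inv_mul]

lemma Circle.norm_inv_pow_mul (w : Circle) (j : ℕ) (a : ℂ) : ‖((w : ℂ) ^ j)⁻¹ * a‖ = ‖a‖ := by
  simp [Circle.norm_coe]

omit [IsFiniteMeasure ν] in
lemma integral_circle_inv_pow (j : ℕ) :
    ∫ z : Circle, ((z : ℂ) ^ j)⁻¹ ∂ν = (starRingEnd ℂ) (∫ z : Circle, (z : ℂ) ^ j ∂ν) := by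
  rw [← integral_conj]
  congr 1
  ext z
  rw [← Circle.coe_pow, ← Circle.coe_inv, Circle.coe_inv_eq_conj]

/-- **Wiener's lemma**: the Fourier coefficients of an atomless measure on the circle are null in
the Cesàro sense. -/
lemma cesaroNull_of_atomless (hν : ∀ z, ν {z} = 0) {c : ℕ → ℝ}
    (hc : ∀ j : ℕ, ∫ z : Circle, (z : ℂ) ^ j ∂ν = c j) : CesaroNull c := by
  have hb : ∀ j, ‖(c j : ℂ)‖ ≤ ν.real Set.univ := fun j => by
    rw [← hc]
    refine (norm_integral_le_integral_norm _).trans ?_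
    simp [Circle.norm_coe]
  have hcont : ∀ j : ℕ, Continuous fun w : Circle => ((w : ℂ) ^ j)⁻¹ * (c j : ℂ) := fun j => by
    fun_prop (disch := simp)
  -- The integrand tends to $\nu\{w\} = 0$. Integrating it in $w$ produces the averages of
  -- $c_j\overline{c_j} = c_j^2$, since the coefficients are real.
  have key : Tendsto
      (fun n => ∫ w : Circle, cesaroMean (fun j => ((w : ℂ) ^ j)⁻¹ * (c j : ℂ)) n ∂ν) atTop
      (𝓝 (∫ _ : Circle, (0 : ℂ) ∂ν)) := by
    refine tendsto_integral_of_dominated_convergence (fun _ => ν.real Set.univ) (fun n => ?_)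
      (integrable_const _) (fun n => .of_forall fun w => ?_) (.of_forall fun w => ?_)
    · refine Continuous.aestronglyMeasurable ?_
      exact (continuous_finsetSum _ fun j _ => hcont j).const_smul _
    · exact norm_cesaroMean_le_of_bounded
        (fun j => by rw [Circle.norm_inv_pow_mul]; exact hb j) n
    · have := tendsto_cesaroMean_integral_atom (ν := ν) w
      simp only [hc, Measure.real, hν] at this
      simpa using this
  apply cesaroNull_of_sq
  rw [← Filter.tendsto_ofReal_iff]
  simp only [integral_zero] at key
  rw [Complex.ofReal_zero]
  refine key.congr fun n => ?_
  rw [integral_cesaroMean fun j => integrable_circle_of_continuous (hcont j)]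
  simp only [integral_mul_const, integral_circle_inv_pow, hc, Complex.conj_ofReal, cesaroMean]
  simp [sq]

end Circle

/-! ### Existence of spectral measures -/

section Herglotz

variable {H : Type*} [NormedAddCommGroup H] [InnerProductSpace ℝ H]

/-- The Fejér density `n⁻¹ ‖∑_{j<n} zʲ ⊗ Vʲ x‖²` on the circle. -/
noncomputable def fejerDensity (V : H →L[ℝ] H) (x : H) (n : ℕ) (t : UnitAddCircle) : ℝ :=
  (1 / (n : ℝ)) * (‖∑ j ∈ Finset.range n, (fourier (j : ℤ) t : ℂ).re • (V ^ j) x‖ ^ 2 +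
    ‖∑ j ∈ Finset.range n, (fourier (j : ℤ) t : ℂ).im • (V ^ j) x‖ ^ 2)

lemma fejerDensity_nonneg (V : H →L[ℝ] H) (x : H) (n : ℕ) (t : UnitAddCircle) :
    0 ≤ fejerDensity V x n t := by
  unfold fejerDensity; positivity

lemma continuous_fejerDensity (V : H →L[ℝ] H) (x : H) (n : ℕ) :
    Continuous (fejerDensity V x n) := by
  unfold fejerDensity
  fun_prop

lemma norm_sq_sum_smul (s : Finset ℕ) (a : ℕ → ℝ) (y : ℕ → H) :
    ‖∑ j ∈ s, a j • y j‖ ^ 2 = ∑ j ∈ s, ∑ l ∈ s, a j * a l * inner ℝ (y j) (y l) := by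
  rw [← real_inner_self_eq_norm_sq, sum_inner]
  refine Finset.sum_congr rfl fun j _ => ?_
  rw [inner_sum]
  refine Finset.sum_congr rfl fun l _ => ?_
  rw [real_inner_smul_left, real_inner_smul_right]; ring

lemma fejerDensity_eq (V : H →L[ℝ] H) (x : H) (n : ℕ) (t : UnitAddCircle) :
    (fejerDensity V x n t : ℂ) = (1 / (n : ℂ)) * ∑ j ∈ Finset.range n, ∑ l ∈ Finset.range n,
      fourier ((j : ℤ) - l) t * (inner ℝ ((V ^ j) x) ((V ^ l) x) : ℝ) := by
  have hf : ∀ j l : ℕ, (fourier ((j : ℤ) - l) t : ℂ) =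
      fourier (j : ℤ) t * (starRingEnd ℂ) (fourier (l : ℤ) t) := fun j l => by
    rw [sub_eq_add_neg, fourier_add, fourier_neg]
  -- The imaginary part of the double sum is antisymmetric under exchange of `j` and `l`.
  have him : ∑ j ∈ Finset.range n, ∑ l ∈ Finset.range n,
      (-((fourier (j : ℤ) t : ℂ).re * (fourier (l : ℤ) t : ℂ).im) +
        (fourier (j : ℤ) t : ℂ).im * (fourier (l : ℤ) t : ℂ).re) *
          inner ℝ ((V ^ j) x) ((V ^ l) x) = 0 := by
    have h2 : ∀ a : ℝ, a = -a → a = 0 := fun a h => by linarith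
    apply h2
    conv_lhs => rw [Finset.sum_comm]
    rw [← Finset.sum_neg_distrib]
    refine Finset.sum_congr rfl fun j _ => ?_
    rw [← Finset.sum_neg_distrib]
    refine Finset.sum_congr rfl fun l _ => ?_
    rw [real_inner_comm]; ring
  rw [fejerDensity, norm_sq_sum_smul, norm_sq_sum_smul]
  rw [Complex.ofReal_mul, Complex.ofReal_div, Complex.ofReal_one, Complex.ofReal_natCast]
  congr 1
  apply Complex.ext
  · simp only [hf, Complex.re_sum, Complex.mul_re, Complex.mul_im, Complex.conj_re,
      Complex.conj_im, Complex.ofReal_re, Complex.ofReal_im, ← Finset.sum_add_distrib]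
    refine Finset.sum_congr rfl fun j _ => Finset.sum_congr rfl fun l _ => ?_
    ring
  · simp only [hf, Complex.im_sum, Complex.mul_re, Complex.mul_im, Complex.conj_re,
      Complex.conj_im, Complex.ofReal_re, Complex.ofReal_im]
    simp only [mul_zero, zero_add, mul_neg]
    exact him.symm

lemma integral_fourier_unitAddCircle (k : ℤ) :
    ∫ t : UnitAddCircle, (fourier k t : ℂ) ∂AddCircle.haarAddCircle = if k = 0 then 1 else 0 := by
  have := congrFun (fourierCoeff_fourier (T := 1) k) 0
  simpa [fourierCoeff, Pi.single_apply, eq_comm] using this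

/-- By orthogonality of characters only the pairs with $l = j + k$ contribute, each with $\langle
V^kx,x\rangle$. There are `n - k` of them, truncated subtraction giving the correct count 0 for $k >
n$. -/
lemma integral_fourier_mul_fejerDensity {V : H →L[ℝ] H} (hV : ∀ x, ‖V x‖ = ‖x‖) (x : H)
    (n k : ℕ) :
    ∫ t : UnitAddCircle, (fourier (k : ℤ) t : ℂ) * (fejerDensity V x n t : ℂ)
      ∂AddCircle.haarAddCircle
      = (1 / (n : ℂ)) * (n - k : ℕ) * (inner ℝ ((V ^ k) x) x : ℝ) := by
  have hint : ∀ m : ℤ, Integrable (fun t : UnitAddCircle => (fourier m t : ℂ))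
      AddCircle.haarAddCircle := fun m =>
    (map_continuous (fourier m)).integrable_of_hasCompactSupport
      (HasCompactSupport.of_compactSpace _)
  have h1 : ∀ t : UnitAddCircle, (fourier (k : ℤ) t : ℂ) * (fejerDensity V x n t : ℂ) =
      (1 / (n : ℂ)) * ∑ j ∈ Finset.range n, ∑ l ∈ Finset.range n,
        fourier ((k : ℤ) + (j - l)) t * (inner ℝ ((V ^ j) x) ((V ^ l) x) : ℝ) := fun t => by
    rw [fejerDensity_eq, mul_left_comm, Finset.mul_sum]
    congr 1
    refine Finset.sum_congr rfl fun j _ => ?_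
    rw [Finset.mul_sum]
    refine Finset.sum_congr rfl fun l _ => ?_
    rw [fourier_add]; ring
  simp_rw [h1]
  rw [integral_const_mul, integral_finsetSum _ fun j _ =>
    integrable_finsetSum _ fun l _ => (hint _).mul_const _]
  rw [mul_assoc]
  congr 1
  have h2 : ∀ j ∈ Finset.range n, ∫ t : UnitAddCircle, ∑ l ∈ Finset.range n,
      fourier ((k : ℤ) + (j - l)) t * ((inner ℝ ((V ^ j) x) ((V ^ l) x) : ℝ) : ℂ)
        ∂AddCircle.haarAddCircle =
      if j ∈ Finset.range (n - k) then ((inner ℝ ((V ^ k) x) x : ℝ) : ℂ) else 0 := by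
    intro j _
    rw [integral_finsetSum _ fun l _ => (hint _).mul_const _]
    simp_rw [integral_mul_const, integral_fourier_unitAddCircle]
    have h3 : ∀ l : ℕ, ((if (k : ℤ) + (j - l) = 0 then (1 : ℂ) else 0) *
        ((inner ℝ ((V ^ j) x) ((V ^ l) x) : ℝ) : ℂ)) =
        if k + j = l then ((inner ℝ ((V ^ k) x) x : ℝ) : ℂ) else 0 := fun l => by
      have : (k : ℤ) + (j - l) = 0 ↔ k + j = l := by omega
      simp only [this]
      split_ifs with h
      · rw [← h, real_inner_comm, inner_pow_add_pow hV, one_mul]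
      · simp
    simp_rw [h3]
    rw [Finset.sum_ite_eq]
    simp only [Finset.mem_range]
    congr 1
    exact propext (by omega)
  rw [Finset.sum_congr rfl h2, Finset.sum_ite_mem,
    Finset.inter_eq_right.2 (Finset.range_mono (Nat.sub_le n k))]
  simp

/-- The measure on the circle with the Fejér density. -/
noncomputable def fejerMeasure (V : H →L[ℝ] H) (x : H) (n : ℕ) : Measure Circle :=
  ((AddCircle.haarAddCircle : Measure UnitAddCircle).withDensity
    fun t => ENNReal.ofReal (fejerDensity V x n t)).map AddCircle.toCircle

lemma integral_pow_fejerMeasure {V : H →L[ℝ] H} (hV : ∀ x, ‖V x‖ = ‖x‖) (x : H) (n k : ℕ) :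
    ∫ z : Circle, (z : ℂ) ^ k ∂(fejerMeasure V x n)
      = (1 / (n : ℂ)) * (n - k : ℕ) * (inner ℝ ((V ^ k) x) x : ℝ) := by
  have hc : Continuous fun z : Circle => (z : ℂ) ^ k := by fun_prop
  rw [fejerMeasure, integral_map AddCircle.continuous_toCircle.measurable.aemeasurable
    hc.aestronglyMeasurable, integral_withDensity_eq_integral_toReal_smul
      (continuous_fejerDensity V x n).measurable.ennreal_ofReal (by simp),
    ← integral_fourier_mul_fejerDensity hV x n k]
  congr 1
  ext t
  rw [ENNReal.toReal_ofReal (fejerDensity_nonneg V x n t), fourier_apply, natCast_zsmul,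
    AddCircle.toCircle_nsmul, Circle.coe_pow, Complex.real_smul, mul_comm]

lemma isProbabilityMeasure_fejerMeasure {V : H →L[ℝ] H} (hV : ∀ x, ‖V x‖ = ‖x‖) {x : H}
    (hx : ‖x‖ = 1) {n : ℕ} (hn : n ≠ 0) : IsProbabilityMeasure (fejerMeasure V x n) := by
  have hi : ∫ t : UnitAddCircle, fejerDensity V x n t ∂AddCircle.haarAddCircle = 1 := by
    have := integral_fourier_mul_fejerDensity hV x n 0
    have hn' : (n : ℂ) ≠ 0 := by exact_mod_cast hn
    simp only [Nat.cast_zero, fourier_zero, one_mul, tsub_zero, pow_zero, one_apply_eq_self,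
      real_inner_self_eq_norm_sq, hx, one_pow, Complex.ofReal_one, mul_one, one_div,
      inv_mul_cancel₀ hn'] at this
    rw [integral_complex_ofReal] at this
    exact_mod_cast this
  refine ⟨?_⟩
  rw [fejerMeasure, Measure.map_apply AddCircle.continuous_toCircle.measurable .univ,
    Set.preimage_univ, withDensity_apply _ .univ, Measure.restrict_univ,
    ← ofReal_integral_eq_lintegral_ofReal _ (.of_forall (fejerDensity_nonneg V x n)), hi,
    ENNReal.ofReal_one]
  exact (continuous_fejerDensity V x n).integrable_of_hasCompactSupport
    (HasCompactSupport.of_compactSpace _)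

/-- Probability measures on the compact circle form a compact space. Any limit of the Fejér measures
works, because the weights $(n-k)/n$ tend to 1. -/
lemma exists_probabilityMeasure_fourier_eq {V : H →L[ℝ] H} (hV : ∀ x, ‖V x‖ = ‖x‖) {x : H}
    (hx : ‖x‖ = 1) : ∃ ν : Measure Circle, IsProbabilityMeasure ν ∧
      ∀ k : ℕ, ∫ z : Circle, (z : ℂ) ^ k ∂ν = (inner ℝ ((V ^ k) x) x : ℝ) := by
  -- The index starts at 1: the Fejér density for `n = 0` is zero.
  let p : ℕ → ProbabilityMeasure Circle := fun n =>
    ⟨fejerMeasure V x (n + 1), isProbabilityMeasure_fejerMeasure hV hx n.succ_ne_zero⟩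
  let F : Ultrafilter ℕ := Ultrafilter.of atTop
  obtain ⟨ν, -, hν⟩ := isCompact_univ.ultrafilter_le_nhds (F.map p) (by simp)
  have hν' : Tendsto p F (𝓝 ν) := hν
  rw [ProbabilityMeasure.tendsto_iff_forall_integral_rclike_tendsto ℂ] at hν'
  refine ⟨ν, inferInstance, fun k => ?_⟩
  have hc : Continuous fun z : Circle => (z : ℂ) ^ k := by fun_prop
  have h1 := hν' (BoundedContinuousFunction.mkOfCompact ⟨_, hc⟩)
  refine tendsto_nhds_unique h1 (Tendsto.mono_left ?_ (Ultrafilter.of_le atTop))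
  change Tendsto (fun n => ∫ z : Circle, (z : ℂ) ^ k ∂(fejerMeasure V x (n + 1))) _ _
  simp_rw [integral_pow_fejerMeasure hV]
  have h2 : Tendsto (fun n : ℕ => (1 / ((n : ℕ) : ℂ)) * ((n - k : ℕ) : ℂ)) atTop (𝓝 1) := by
    have h3 : Tendsto (fun n : ℕ => 1 - (k : ℂ) * (1 / (n : ℂ))) atTop (𝓝 1) := by
      simpa using ((tendsto_one_div_atTop_nhds_zero_nat (𝕜 := ℂ)).const_mul (k : ℂ)).const_sub 1
    refine h3.congr' ?_
    filter_upwards [eventually_ge_atTop k, eventually_ne_atTop 0] with n hk hn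
    have hn' : (n : ℂ) ≠ 0 := by exact_mod_cast hn
    rw [Nat.cast_sub hk]
    field_simp
  have h4 := ((tendsto_add_atTop_iff_nat 1).2 h2).mul_const ((inner ℝ ((V ^ k) x) x : ℝ) : ℂ)
  simpa using h4

/-- **Herglotz' theorem** for the correlation sequence of a vector under an isometry. -/
lemma exists_measure_fourier_eq {V : H →L[ℝ] H} (hV : ∀ x, ‖V x‖ = ‖x‖) (x : H) :
    ∃ ν : Measure Circle, IsFiniteMeasure ν ∧
      ∀ k : ℕ, ∫ z : Circle, (z : ℂ) ^ k ∂ν = (inner ℝ ((V ^ k) x) x : ℝ) := by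
  rcases eq_or_ne x 0 with rfl | hx
  · exact ⟨0, inferInstance, by simp⟩
  have hx' : ‖x‖ ≠ 0 := norm_ne_zero_iff.2 hx
  obtain ⟨ν, _, hν⟩ := exists_probabilityMeasure_fourier_eq hV (x := ‖x‖⁻¹ • x)
    (by rw [norm_smul, norm_inv, norm_norm, inv_mul_cancel₀ hx'])
  refine ⟨ENNReal.ofReal (‖x‖ ^ 2) • ν, ν.smul_finite ENNReal.ofReal_ne_top, fun k => ?_⟩
  rw [integral_smul_measure, hν, ENNReal.toReal_ofReal (by positivity), map_smul,
    real_inner_smul_left, real_inner_smul_right, Complex.real_smul, ← Complex.ofReal_mul]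
  congr 1
  field_simp

end Herglotz

section SpectralMeasure

variable {H : Type*} [NormedAddCommGroup H] [InnerProductSpace ℝ H] [CompleteSpace H]

lemma norm_adjoint_apply_of_comp_adjoint {S : H →L[ℝ] H}
    (hS : S ∘L ContinuousLinearMap.adjoint S = ContinuousLinearMap.id ℝ H) (x : H) :
    ‖ContinuousLinearMap.adjoint S x‖ = ‖x‖ := by
  have h : ‖ContinuousLinearMap.adjoint S x‖ ^ 2 = ‖x‖ ^ 2 := by
    rw [← real_inner_self_eq_norm_sq, ContinuousLinearMap.adjoint_inner_left,
      ← ContinuousLinearMap.comp_apply, hS, ContinuousLinearMap.id_apply,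
      real_inner_self_eq_norm_sq]
  exact (sq_eq_sq₀ (norm_nonneg _) (norm_nonneg _)).1 h

lemma adjoint_pow (S : H →L[ℝ] H) (n : ℕ) :
    ContinuousLinearMap.adjoint (S ^ n) = ContinuousLinearMap.adjoint S ^ n := by
  simpa only [ContinuousLinearMap.star_eq_adjoint] using star_pow S n

lemma inner_pow_left (S : H →L[ℝ] H) (n : ℕ) (x y : H) :
    inner ℝ ((S ^ n) x) y = inner ℝ ((ContinuousLinearMap.adjoint S ^ n) y) x := by
  rw [← adjoint_pow, ContinuousLinearMap.adjoint_inner_left, real_inner_comm]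

lemma IsSpectralMeasure.integral_pow {S : H →L[ℝ] H} {x : H} {ν : Measure Circle}
    (h : IsSpectralMeasure S x ν) (j : ℕ) :
    ∫ z : Circle, (z : ℂ) ^ j ∂ν = (inner ℝ ((S ^ j) x) x : ℝ) := by
  simpa [intPow] using h.fourier j

/-- Herglotz applies to the isometry $S^*$, not to `S`. As `H` is real, $\langle S^nx,x\rangle =
\langle S^{*n}x,x\rangle$, so the coefficients are real and symmetric and no restriction to the
unitary part is needed. -/
lemma exists_isSpectralMeasure {S : H →L[ℝ] H}
    (hS : S ∘L ContinuousLinearMap.adjoint S = ContinuousLinearMap.id ℝ H) (x : H) :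
    ∃ ν, IsSpectralMeasure S x ν := by
  obtain ⟨ν, hν, h⟩ := exists_measure_fourier_eq (norm_adjoint_apply_of_comp_adjoint hS) x
  refine ⟨ν, hν, fun k => ?_⟩
  obtain ⟨n, rfl | rfl⟩ := k.eq_nat_or_neg
  · simp only [zpow_natCast, h, intPow, Int.natCast_nonneg, if_true, Int.toNat_natCast,
      inner_pow_left S]
  · rcases n.eq_zero_or_pos with rfl | hn
    · simpa [intPow] using h 0
    · simp only [zpow_neg, zpow_natCast, integral_circle_inv_pow, h, Complex.conj_ofReal]
      rw [intPow, if_neg (by omega), neg_neg, Int.toNat_natCast, adjoint_pow]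

lemma IsSpectralMeasure.cesaroNull {S : H →L[ℝ] H} {x : H} {ν : Measure Circle}
    (h : IsSpectralMeasure S x ν) (hν : ∀ z, ν {z} = 0) :
    CesaroNull fun j => inner ℝ ((S ^ j) x) x :=
  have := h.isFiniteMeasure
  cesaroNull_of_atomless hν h.integral_pow

lemma IsSpectralMeasure.atom_eq_zero {S : H →L[ℝ] H} {x : H} {ν : Measure Circle}
    (h : IsSpectralMeasure S x ν) (w : Circle)
    (hw : Tendsto (cesaroMean fun j => ((w : ℂ) ^ j)⁻¹ * (inner ℝ ((S ^ j) x) x : ℝ)) atTop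
      (𝓝 0)) :
    ν {w} = 0 := by
  have := h.isFiniteMeasure
  have h1 := tendsto_cesaroMean_integral_atom (ν := ν) w
  simp only [h.integral_pow] at h1
  have h2 : ν.real {w} = 0 := by exact_mod_cast tendsto_nhds_unique h1 hw
  exact (measureReal_eq_zero_iff).1 h2

lemma IsSpectralMeasure.atomless_of_cesaroNull {S : H →L[ℝ] H} {x : H} {ν : Measure Circle}
    (h : IsSpectralMeasure S x ν) (hc : CesaroNull fun j => inner ℝ ((S ^ j) x) x) (w : Circle) :
    ν {w} = 0 := by
  refine h.atom_eq_zero w (squeeze_zero_norm (fun n => norm_cesaroMean_le _ n) ?_)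
  simpa only [Circle.norm_inv_pow_mul, Complex.norm_real, Real.norm_eq_abs] using! hc

end SpectralMeasure

/-! ### Rotation planes and Cesàro decay of correlations -/

section MeanErgodic

variable {E : Type*} [NormedAddCommGroup E] [InnerProductSpace ℝ E] [CompleteSpace E]

lemma exists_fixed_tendsto_cesaroMean_pow (K : E →L[ℝ] E) (hK : ‖K‖ ≤ 1) (x : E) :
    ∃ y, K y = y ∧ Tendsto (cesaroMean fun j => (K ^ j) x) atTop (𝓝 y) := by
  -- Von Neumann's theorem is used at `K x`, since Birkhoff averages start at exponent 0 and
  -- `cesaroMean` at exponent 1.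
  have h := K.tendsto_birkhoffAverage_orthogonalProjection hK (K x)
  refine ⟨_, ?_, h.congr fun n => ?_⟩
  · exact LinearMap.mem_eqLocus.1 (Submodule.coe_mem _)
  · rw [cesaroMean, sum_Icc_one_eq_sum_range, birkhoffAverage, birkhoffSum, one_div]
    simp only [id, pow_succ, mul_apply_eq_comp, FunLike.coe_pow_eq_iterate]

end MeanErgodic

section Rotation

variable {H : Type*} [NormedAddCommGroup H] [InnerProductSpace ℝ H]

lemma IsRotationPlane.exists_orthonormal {S : H →L[ℝ] H} {M : Submodule ℝ H}
    (h : IsRotationPlane S M) : ∃ (u v : H) (θ : ℝ), ‖u‖ = 1 ∧ ‖v‖ = 1 ∧ inner ℝ u v = 0 ∧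
      (∀ n : ℕ, (S ^ n) u = Real.cos (n * θ) • u + Real.sin (n * θ) • v) ∧
      ∀ n : ℕ, (S ^ n) v = -Real.sin (n * θ) • u + Real.cos (n * θ) • v := by
  obtain ⟨b, θ, h0, h1⟩ := h
  have key : ∀ n : ℕ, (S ^ n) (b 0 : H) = Real.cos (n * θ) • (b 0 : H) +
      Real.sin (n * θ) • (b 1 : H) ∧
      (S ^ n) (b 1 : H) = -Real.sin (n * θ) • (b 0 : H) + Real.cos (n * θ) • (b 1 : H) := by
    intro n
    induction n with
    | zero => simp
    | succ n ih =>
      obtain ⟨ih0, ih1⟩ := ih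
      simp only [pow_succ', mul_apply_eq_comp, ih0, ih1, map_add, map_smul, h0, h1]
      push_cast
      rw [add_mul, one_mul, Real.cos_add, Real.sin_add]
      constructor <;> module
  refine ⟨b 0, b 1, θ, ?_, ?_, ?_, fun n => (key n).1, fun n => (key n).2⟩
  · exact b.orthonormal.1 0
  · exact b.orthonormal.1 1
  · exact b.orthonormal.2 (show (0 : Fin 2) ≠ 1 by simp)

lemma norm_sq_smul_add_smul (a b : ℝ) (u v : H) :
    ‖a • u + b • v‖ ^ 2 = a ^ 2 * ‖u‖ ^ 2 + 2 * (a * b * inner ℝ u v) + b ^ 2 * ‖v‖ ^ 2 := by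
  rw [norm_add_sq_real, norm_smul, norm_smul, real_inner_smul_left, real_inner_smul_right, mul_pow,
    mul_pow, Real.norm_eq_abs, Real.norm_eq_abs, sq_abs, sq_abs]
  ring

/-- A complex eigenvector `u + i v` of a contraction, for a non-real eigenvalue of modulus one, has
orthogonal real and imaginary parts of the same length. -/
lemma norm_eq_and_inner_eq_zero_of_rotation {S : H →L[ℝ] H} (hS : ∀ x, ‖S x‖ ≤ ‖x‖) {u v : H}
    {c s : ℝ} (hcs : c ^ 2 + s ^ 2 = 1) (hs : s ≠ 0) (hu : S u = c • u + (-s) • v)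
    (hv : S v = s • u + c • v) : ‖u‖ = ‖v‖ ∧ inner ℝ u v = 0 := by
  have hsq : ∀ x, ‖S x‖ ^ 2 ≤ ‖x‖ ^ 2 := fun x => by gcongr; exact hS x
  have h1 := hsq u
  have h2 := hsq v
  have h3 := hsq (u + v)
  have h4 := hsq (u - v)
  have e3 : S (u + v) = (c + s) • u + (c - s) • v := by rw [map_add, hu, hv]; module
  have e4 : S (u - v) = (c - s) • u + (-s - c) • v := by rw [map_sub, hu, hv]; module
  rw [hu, norm_sq_smul_add_smul] at h1
  rw [hv, norm_sq_smul_add_smul] at h2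
  rw [e3, norm_sq_smul_add_smul, norm_add_sq_real] at h3
  rw [e4, norm_sq_smul_add_smul, norm_sub_sq_real] at h4
  set p := ‖u‖ ^ 2 with hp
  set q := ‖v‖ ^ 2 with hq
  set r : ℝ := inner ℝ u v
  have hc2 : c ^ 2 = 1 - s ^ 2 := by linarith
  -- The contraction inequalities at `u` and `v` bound this quantity from both sides; those at `u +
  -- v` and `u - v` do the same for `k2`. After division by `s`, this is a linear system in $p - q$
  -- and $2r$ with determinant $c^2 + s^2 = 1$.
  have k1 : s * (s * (q - p) - 2 * (c * r)) = 0 := by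
    apply le_antisymm <;> nlinarith
  have k2 : s * (c * (p - q) - 2 * (s * r)) = 0 := by
    apply le_antisymm
    · linear_combination (1 / 2) * h3 - (1 / 2) * (p + q + 2 * r) * hcs
    · linear_combination (1 / 2) * h4 - (1 / 2) * (p + q - 2 * r) * hcs
  replace k1 := (mul_eq_zero.1 k1).resolve_left hs
  replace k2 := (mul_eq_zero.1 k2).resolve_left hs
  have hpq : p - q = 0 := by linear_combination (p - q) * (-hcs) + c * k2 - s * k1
  have hr : r = 0 := by linear_combination (-r) * hcs - (1 / 2) * (c * k1 + s * k2)
  refine ⟨?_, hr⟩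
  exact (sq_eq_sq₀ (norm_nonneg _) (norm_nonneg _)).1 (by linarith)

lemma exists_isRotationPlane {S : H →L[ℝ] H} {u v : H} (huv : ‖u‖ = ‖v‖) (h0 : inner ℝ u v = 0)
    (hu0 : u ≠ 0) {θ : ℝ} (hu : S u = Real.cos θ • u + Real.sin θ • v)
    (hv : S v = -Real.sin θ • u + Real.cos θ • v) : ∃ M, IsRotationPlane S M := by
  have hn : ‖u‖ ≠ 0 := norm_ne_zero_iff.2 hu0
  let w : Fin 2 → H := ![‖u‖⁻¹ • u, ‖u‖⁻¹ • v]
  have hw : Orthonormal ℝ w := by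
    refine ⟨fun i => ?_, fun i j hij => ?_⟩
    · fin_cases i
      · simp [w, norm_smul, hn]
      · simp [w, norm_smul, huv, huv ▸ hn]
    · fin_cases i <;> fin_cases j
      · exact absurd rfl hij
      · simp [w, real_inner_smul_left, real_inner_smul_right, h0]
      · simp [w, real_inner_smul_right, real_inner_comm, h0]
      · exact absurd rfl hij
  let b := Module.Basis.span hw.linearIndependent
  have hb : ∀ i, (b i : H) = w i := fun i => by simp [b, Module.Basis.span_apply]
  have hbo : Orthonormal ℝ b := by
    refine ⟨fun i => ?_, fun i j hij => ?_⟩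
    · change ‖(b i : H)‖ = 1
      rw [hb]; exact hw.1 i
    · change inner ℝ (b i : H) (b j : H) = 0
      rw [hb, hb]; exact hw.2 hij
  refine ⟨_, b.toOrthonormalBasis hbo, θ, ?_, ?_⟩
  · simp only [Module.Basis.coe_toOrthonormalBasis, hb]
    simp only [w, Matrix.cons_val_zero, Matrix.cons_val_one, map_smul, hu]
    module
  · simp only [Module.Basis.coe_toOrthonormalBasis, hb]
    simp only [w, Matrix.cons_val_zero, Matrix.cons_val_one, map_smul, hv]
    module

lemma exists_isOrthogonalLine {S : H →L[ℝ] H} {u : H} (hu : u ≠ 0) (h : S u = u ∨ S u = -u) :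
    ∃ M, IsOrthogonalLine S M := by
  refine ⟨Submodule.span ℝ {u}, finrank_span_singleton hu, ?_⟩
  rcases h with h | h
  · left
    intro x hx
    obtain ⟨a, rfl⟩ := Submodule.mem_span_singleton.1 hx
    rw [map_smul, h]
  · right
    intro x hx
    obtain ⟨a, rfl⟩ := Submodule.mem_span_singleton.1 hx
    rw [map_smul, h, smul_neg]

/-- The hypotheses make `u + i v` an eigenvector of the complexification of `S` with eigenvalue
$e^{i\theta}$. A real eigenvalue would give a line, a non-real one a plane. -/
lemma eq_zero_of_rotation {S : H →L[ℝ] H} (hS : ∀ x, ‖S x‖ ≤ ‖x‖)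
    (hM : ∀ M : Submodule ℝ H, ¬ IsRotationPlane S M ∧ ¬ IsOrthogonalLine S M) {u v : H} {θ : ℝ}
    (hu : S u = Real.cos θ • u + (-Real.sin θ) • v) (hv : S v = Real.sin θ • u + Real.cos θ • v) :
    u = 0 ∧ v = 0 := by
  by_cases hs : Real.sin θ = 0
  · have hline : ∀ x, S x = Real.cos θ • x → x = 0 := by
      intro x hx
      by_contra hx0
      have hc : Real.cos θ = 1 ∨ Real.cos θ = -1 := by
        have := Real.sin_sq_add_cos_sq θ
        rw [hs] at this
        exact mul_self_eq_one_iff.1 (by nlinarith)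
      obtain ⟨M, hM'⟩ := exists_isOrthogonalLine (S := S) hx0 (by
        rcases hc with hc | hc <;> simp [hx, hc])
      exact (hM M).2 hM'
    exact ⟨hline u (by simpa [hs] using hu), hline v (by simpa [hs] using hv)⟩
  · obtain ⟨huv, h0⟩ := norm_eq_and_inner_eq_zero_of_rotation hS (Real.cos_sq_add_sin_sq θ) hs hu hv
    have hu0 : u = 0 := by
      by_contra hu0
      obtain ⟨M, hM'⟩ := exists_isRotationPlane (S := S) (θ := -θ) huv h0 hu0
        (by simpa using hu) (by simpa using hv)
      exact (hM M).1 hM'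
    exact ⟨hu0, by rwa [hu0, norm_zero, eq_comm, norm_eq_zero] at huv⟩

/-- The operator `e^{-iθ} ⊗ S` on the complexification `H × H` of `H`. -/
noncomputable def twist (S : H →L[ℝ] H) (θ : ℝ) : WithLp 2 (H × H) →L[ℝ] WithLp 2 (H × H) :=
  ((WithLp.prodContinuousLinearEquiv 2 ℝ H H).symm : H × H →L[ℝ] WithLp 2 (H × H)) ∘L
    ((Real.cos θ • S ∘L WithLp.fstL 2 ℝ H H + Real.sin θ • S ∘L WithLp.sndL 2 ℝ H H).prod
      (-Real.sin θ • S ∘L WithLp.fstL 2 ℝ H H + Real.cos θ • S ∘L WithLp.sndL 2 ℝ H H))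

lemma twist_apply (S : H →L[ℝ] H) (θ : ℝ) (z : WithLp 2 (H × H)) :
    twist S θ z = WithLp.toLp 2 (Real.cos θ • S z.fst + Real.sin θ • S z.snd,
      -Real.sin θ • S z.fst + Real.cos θ • S z.snd) := rfl

lemma norm_twist_le {S : H →L[ℝ] H} (hS : ∀ x, ‖S x‖ ≤ ‖x‖) (θ : ℝ) : ‖twist S θ‖ ≤ 1 := by
  refine ContinuousLinearMap.opNorm_le_bound _ zero_le_one fun z => ?_
  rw [one_mul]
  refine (sq_le_sq₀ (norm_nonneg _) (norm_nonneg _)).1 ?_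
  rw [twist_apply, WithLp.prod_norm_sq_eq_of_L2, WithLp.prod_norm_sq_eq_of_L2]
  simp only [WithLp.toLp_fst, WithLp.toLp_snd]
  rw [norm_sq_smul_add_smul, norm_sq_smul_add_smul]
  have h1 : ‖S z.fst‖ ^ 2 ≤ ‖z.fst‖ ^ 2 := by gcongr; exact hS _
  have h2 : ‖S z.snd‖ ^ 2 ≤ ‖z.snd‖ ^ 2 := by gcongr; exact hS _
  have h3 := Real.cos_sq_add_sin_sq θ
  calc _ = (Real.cos θ ^ 2 + Real.sin θ ^ 2) * (‖S z.fst‖ ^ 2 + ‖S z.snd‖ ^ 2) := by ring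
    _ ≤ _ := by rw [h3, one_mul]; exact add_le_add h1 h2

lemma twist_pow_apply (S : H →L[ℝ] H) (θ : ℝ) (x : H) (n : ℕ) :
    (twist S θ ^ n) (WithLp.toLp 2 (x, 0)) =
      WithLp.toLp 2 (Real.cos (n * θ) • (S ^ n) x, -Real.sin (n * θ) • (S ^ n) x) := by
  induction n with
  | zero => simp
  | succ n ih =>
    rw [pow_succ', mul_apply_eq_comp, ih, twist_apply, pow_succ', mul_apply_eq_comp]
    simp only [WithLp.toLp_fst, WithLp.toLp_snd, map_smul]
    push_cast
    rw [add_mul, one_mul, Real.cos_add, Real.sin_add]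
    congr 2 <;> module

variable [CompleteSpace H]

/-- These averages are the pairing with `x` of the ergodic averages of $e^{-i\theta}\otimes S$ at
`x`. Their limit is a fixed vector of that contraction, hence an eigenvector of the complexified
`S`, which the hypothesis excludes. -/
lemma tendsto_cesaroMean_inv_pow_mul_inner {S : H →L[ℝ] H} (hS : ∀ x, ‖S x‖ ≤ ‖x‖)
    (hM : ∀ M : Submodule ℝ H, ¬ IsRotationPlane S M ∧ ¬ IsOrthogonalLine S M) (x : H)
    (w : Circle) :
    Tendsto (cesaroMean fun j => ((w : ℂ) ^ j)⁻¹ * (inner ℝ ((S ^ j) x) x : ℝ)) atTop (𝓝 0) := by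
  obtain ⟨θ, rfl⟩ : ∃ θ, Circle.exp θ = w := ⟨_, Circle.exp_arg w⟩
  obtain ⟨y, hy, hlim⟩ := exists_fixed_tendsto_cesaroMean_pow (twist S θ) (norm_twist_le hS θ)
    (WithLp.toLp 2 (x, 0))
  have hy1 : Real.cos θ • S y.fst + Real.sin θ • S y.snd = y.fst := congrArg WithLp.fst hy
  have hy2 : -Real.sin θ • S y.fst + Real.cos θ • S y.snd = y.snd := congrArg WithLp.snd hy
  have hcs := Real.cos_sq_add_sin_sq θ
  -- Undoing the rotation by `θ` turns the fixed-vector equations into eigenvector equations for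
  -- `S`.
  have hrot : ∀ a b u v : H, Real.cos θ • a + Real.sin θ • b = u →
      -Real.sin θ • a + Real.cos θ • b = v →
      a = Real.cos θ • u + (-Real.sin θ) • v ∧ b = Real.sin θ • u + Real.cos θ • v := by
    rintro a b _ _ rfl rfl
    constructor <;> match_scalars <;> first | ring1 | linear_combination -hcs
  obtain ⟨h1, h2⟩ := eq_zero_of_rotation hS hM (hrot _ _ _ _ hy1 hy2).1 (hrot _ _ _ _ hy1 hy2).2
  have hy0 : y = 0 := by
    apply (WithLp.prodContinuousLinearEquiv 2 ℝ H H).injective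
    exact Prod.ext h1 h2
  let Ψ : WithLp 2 (H × H) →L[ℝ] ℂ :=
    Complex.ofRealCLM ∘L innerSL ℝ x ∘L WithLp.fstL 2 ℝ H H +
      Complex.I • Complex.ofRealCLM ∘L innerSL ℝ x ∘L WithLp.sndL 2 ℝ H H
  have hΨ : ∀ z, Ψ z = (inner ℝ x z.fst : ℝ) + Complex.I * (inner ℝ x z.snd : ℝ) := fun z => rfl
  have h3 := (Ψ.continuous.tendsto y).comp hlim
  rw [hy0, map_zero] at h3
  refine h3.congr fun n => ?_
  rw [Function.comp_apply, map_cesaroMean]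
  congr 1
  ext j
  rw [twist_pow_apply, hΨ, ← Circle.coe_pow, ← Circle.coe_inv, ← Circle.exp_nsmul, ← Circle.exp_neg,
    Circle.coe_exp]
  simp only [nsmul_eq_mul, WithLp.toLp_fst, WithLp.toLp_snd, real_inner_smul_right,
    real_inner_comm x]
  generalize inner ℝ x ((S ^ j) x) = a
  rw [Complex.exp_mul_I]
  push_cast
  rw [Complex.cos_neg, Complex.sin_neg]
  ring

/-- A coisometry without rotation planes has correlations that are null in the Cesàro sense. -/
theorem cesaroNull_inner_of_forall_not_isRotationPlane {S : H →L[ℝ] H}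
    (hS : S ∘L ContinuousLinearMap.adjoint S = ContinuousLinearMap.id ℝ H)
    (hM : ∀ M : Submodule ℝ H, ¬ IsRotationPlane S M ∧ ¬ IsOrthogonalLine S M) (x y : H) :
    CesaroNull fun j => inner ℝ ((S ^ j) x) y := by
  have hV := norm_adjoint_apply_of_comp_adjoint hS
  have hS1 : ∀ x, ‖S x‖ ≤ ‖x‖ := fun x => by
    have h1 : ‖ContinuousLinearMap.adjoint S‖ ≤ 1 :=
      ContinuousLinearMap.opNorm_le_bound _ zero_le_one fun x => by rw [hV, one_mul]
    rw [LinearIsometryEquiv.norm_map] at h1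
    simpa using S.le_of_opNorm_le h1 x
  -- The spectral measure is taken at `y`: moving the powers across the inner product makes `y` the
  -- vector that the isometry $S^*$ transports.
  obtain ⟨ν, hν⟩ := exists_isSpectralMeasure hS y
  have h := hν.cesaroNull fun w =>
    hν.atom_eq_zero w (tendsto_cesaroMean_inv_pow_mul_inner hS1 hM y w)
  simp only [inner_pow_left S] at h ⊢
  exact cesaroNull_inner_of_self hV h x

/-- Expanding the square gives $\|S^{*n}S^nx - x\|^2 = \|x\|^2 - \|S^nx\|^2 = 0$. -/
lemma mem_unitaryPart_of_norm_pow_apply {S : H →L[ℝ] H}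
    (hS : S ∘L ContinuousLinearMap.adjoint S = ContinuousLinearMap.id ℝ H) {x : H}
    (hx : ∀ n : ℕ, ‖(S ^ n) x‖ = ‖x‖) : x ∈ unitaryPart S := by
  rw [unitaryPart, Submodule.mem_iInf]
  intro n
  refine ⟨(S ^ n) x, ?_⟩
  rw [ContinuousLinearMap.coe_coe, ← sub_eq_zero, ← norm_eq_zero, ← sq_eq_zero_iff,
    norm_sub_sq_real, ContinuousLinearMap.adjoint_inner_left, real_inner_self_eq_norm_sq,
    adjoint_pow, norm_pow_apply (norm_adjoint_apply_of_comp_adjoint hS), hx]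
  ring

lemma not_cesaroNull_const {a : ℝ} (ha : a ≠ 0) : ¬ CesaroNull fun _ => a := by
  intro h
  have h1 : Tendsto (cesaroMean fun _ => |a|) atTop (𝓝 |a|) := by
    refine tendsto_const_nhds.congr' ?_
    filter_upwards [eventually_ne_atTop 0] with n hn
    rw [cesaroMean_const _ hn]
  exact ha (abs_eq_zero.1 (tendsto_nhds_unique h1 h))

/-- If the vectors of the unitary part have atomless spectral measures, there is no rotation
plane. -/
theorem not_isRotationPlane_of_atomless {S : H →L[ℝ] H}
    (hS : S ∘L ContinuousLinearMap.adjoint S = ContinuousLinearMap.id ℝ H)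
    (h : ∀ x ∈ unitaryPart S, ∃ ν : Measure Circle, IsSpectralMeasure S x ν ∧ ∀ z, ν {z} = 0)
    (M : Submodule ℝ H) : ¬ IsRotationPlane S M ∧ ¬ IsOrthogonalLine S M := by
  have key : ∀ x, (∀ n : ℕ, ‖(S ^ n) x‖ = ‖x‖) → ∀ y,
      CesaroNull fun j => inner ℝ ((S ^ j) y) x := by
    intro x hx y
    obtain ⟨ν, hν, hat⟩ := h x (mem_unitaryPart_of_norm_pow_apply hS hx)
    have h1 := hν.cesaroNull hat
    simp only [inner_pow_left S] at h1 ⊢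
    exact cesaroNull_inner_of_self (norm_adjoint_apply_of_comp_adjoint hS) h1 y
  constructor
  · intro hM
    obtain ⟨u, v, θ, hu, hv, huv, hSu, hSv⟩ := hM.exists_orthonormal
    have hx : ∀ n : ℕ, ‖(S ^ n) u‖ = ‖u‖ := fun n => by
      refine (sq_eq_sq₀ (norm_nonneg _) (norm_nonneg _)).1 ?_
      rw [hSu, norm_sq_smul_add_smul, hu, hv, huv]
      linarith [Real.cos_sq_add_sin_sq (n * θ)]
    have h1 : ∀ n : ℕ, inner ℝ ((S ^ n) u) u = Real.cos (n * θ) := fun n => by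
      rw [hSu, inner_add_left, real_inner_smul_left, real_inner_smul_left,
        real_inner_self_eq_norm_sq, real_inner_comm, huv, hu]; ring
    have h2 : ∀ n : ℕ, inner ℝ ((S ^ n) v) u = -Real.sin (n * θ) := fun n => by
      rw [hSv, inner_add_left, real_inner_smul_left, real_inner_smul_left,
        real_inner_self_eq_norm_sq, real_inner_comm, huv, hu]; ring
    have k1 := key u hx u
    have k2 := key u hx v
    simp only [h1, h2] at k1 k2
    -- If $\cos(j\theta)$ and $\sin(j\theta)$ were Cesàro null, so would be the sum of their
    -- squares, the constant 1.
    refine not_cesaroNull_const one_ne_zero <| (isNullNotion_cesaroNull.add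
      (k1.of_le (c := fun j : ℕ => Real.cos (j * θ) ^ 2) 1 fun j => ?_)
      (k2.of_le (c := fun j : ℕ => Real.sin (j * θ) ^ 2) 1 fun j => ?_)).of_le 1 fun j => ?_
    · rw [abs_pow, sq]
      exact mul_le_mul_of_nonneg_right (Real.abs_cos_le_one _) (abs_nonneg _)
    · rw [abs_pow, sq, abs_neg]
      exact mul_le_mul_of_nonneg_right (Real.abs_sin_le_one _) (abs_nonneg _)
    · rw [Real.cos_sq_add_sin_sq, one_mul]
  · rintro ⟨hM1, hM2⟩
    obtain ⟨x, hxM, hx0⟩ : ∃ x ∈ M, x ≠ 0 := by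
      by_contra! hall
      rw [(Submodule.eq_bot_iff M).2 hall, finrank_bot] at hM1
      exact zero_ne_one hM1
    have hSn : ∀ n : ℕ, (S ^ n) x = x ∨ (S ^ n) x = -x := by
      intro n
      induction n with
      | zero => simp
      | succ n ih =>
        rw [pow_succ', mul_apply_eq_comp]
        rcases hM2 with h2 | h2 <;> rcases ih with h3 | h3 <;> simp [h3, h2 x hxM]
    have hx : ∀ n : ℕ, ‖(S ^ n) x‖ = ‖x‖ := fun n => by
      rcases hSn n with h3 | h3 <;> simp [h3]
    refine not_cesaroNull_const (a := ‖x‖ ^ 2) (by positivity) ((key x hx x).of_le 1 fun j => ?_)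
    rw [one_mul]
    rcases hSn j with h3 | h3 <;> simp [h3, inner_neg_left]

end Rotation

/-! ### The Wiener isometry -/

section DualVec

variable {X H : Type*} [NormedAddCommGroup X] [NormedSpace ℝ X]
  [NormedAddCommGroup H] [InnerProductSpace ℝ H] [CompleteSpace H]

/-- The vector of `H` representing the functional `ℓ ∘ ι`. -/
noncomputable def dualVec (ι : H →L[ℝ] X) : StrongDual ℝ X →ₗ[ℝ] H where
  toFun ℓ := (InnerProductSpace.toDual ℝ H).symm (ℓ.comp ι)
  map_add' ℓ m := by rw [ContinuousLinearMap.add_comp, map_add]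
  map_smul' c ℓ := by
    rw [ContinuousLinearMap.smul_comp, LinearIsometryEquiv.map_smulₛₗ]; rfl

lemma inner_dualVec (ι : H →L[ℝ] X) (ℓ : StrongDual ℝ X) (h : H) :
    inner ℝ (dualVec ι ℓ) h = ℓ (ι h) :=
  InnerProductSpace.toDual_symm_apply

lemma norm_dualVec (ι : H →L[ℝ] X) (ℓ : StrongDual ℝ X) : ‖dualVec ι ℓ‖ = ‖ℓ.comp ι‖ :=
  (InnerProductSpace.toDual ℝ H).symm.norm_map (ℓ.comp ι)

/-- A vector orthogonal to the range is sent by $\iota$ to a point where every functional vanishes.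
-/
lemma denseRange_dualVec {ι : H →L[ℝ] X} (hι : Function.Injective ι) :
    DenseRange (dualVec ι) := by
  have : (LinearMap.range (dualVec ι)).topologicalClosure = ⊤ := by
    rw [Submodule.topologicalClosure_eq_top_iff, Submodule.eq_bot_iff]
    intro h hh
    apply hι
    rw [map_zero]
    refine SeparatingDual.eq_zero_of_forall_dual_eq_zero (R := ℝ) fun ℓ => ?_
    rw [← inner_dualVec]
    exact Submodule.inner_right_of_mem_orthogonal (LinearMap.mem_range_self _ ℓ) hh
  have h2 := Submodule.dense_iff_topologicalClosure_eq_top.2 this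
  rwa [LinearMap.coe_range] at h2

end DualVec

section Wiener

variable {X H : Type*} [NormedAddCommGroup X] [NormedSpace ℝ X] [CompleteSpace X]
  [SecondCountableTopology X] [MeasurableSpace X] [BorelSpace X]
  [NormedAddCommGroup H] [InnerProductSpace ℝ H] [CompleteSpace H]
  {ι : H →L[ℝ] X} {μ : Measure X}

namespace IsAbstractWienerSpace

lemma coeFn_toLp (hW : IsAbstractWienerSpace ι μ) (ℓ : StrongDual ℝ X) :
    StrongDual.toLp μ 2 ℓ =ᵐ[μ] ℓ := by
  have := hW.isGaussian
  rw [StrongDual.toLp_apply IsGaussian.memLp_two_id]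
  exact MemLp.coeFn_toLp _

lemma norm_toLp (hW : IsAbstractWienerSpace ι μ) (ℓ : StrongDual ℝ X) :
    ‖StrongDual.toLp μ 2 ℓ‖ = ‖dualVec ι ℓ‖ := by
  have h : ‖StrongDual.toLp μ 2 ℓ‖ ^ 2 = ‖dualVec ι ℓ‖ ^ 2 := by
    rw [norm_dualVec, ← hW.covariance, ← real_inner_self_eq_norm_sq, L2.inner_def]
    refine integral_congr_ae ?_
    filter_upwards [hW.coeFn_toLp ℓ] with x hx
    rw [real_inner_self_eq_norm_sq, Real.norm_eq_abs, sq_abs, hx]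
  exact (sq_eq_sq₀ (norm_nonneg _) (norm_nonneg _)).1 h

end IsAbstractWienerSpace

/-- The Wiener integral `H → L²(μ)`: the continuous extension of `ι* ℓ ↦ ℓ`. -/
noncomputable def wienerMap (ι : H →L[ℝ] X) (μ : Measure X) : H →L[ℝ] Lp ℝ 2 μ :=
  ((StrongDual.toLp μ 2 : StrongDual ℝ X →L[ℝ] Lp ℝ 2 μ) :
    StrongDual ℝ X →ₗ[ℝ] Lp ℝ 2 μ).extendOfNorm (dualVec ι)

namespace IsAbstractWienerSpace

lemma wienerMap_dualVec (hW : IsAbstractWienerSpace ι μ) (ℓ : StrongDual ℝ X) :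
    wienerMap ι μ (dualVec ι ℓ) = StrongDual.toLp μ 2 ℓ :=
  LinearMap.extendOfNorm_eq (denseRange_dualVec hW.injective)
    ⟨1, fun ℓ => by rw [one_mul]; exact (hW.norm_toLp ℓ).le⟩ ℓ

lemma norm_wienerMap (hW : IsAbstractWienerSpace ι μ) (h : H) : ‖wienerMap ι μ h‖ = ‖h‖ := by
  refine (denseRange_dualVec hW.injective).induction_on h ?_ fun ℓ => ?_
  · exact isClosed_eq (by fun_prop) (by fun_prop)
  · rw [hW.wienerMap_dualVec, hW.norm_toLp]

/-- Convergence in $L^2$ holds a.e. along a subsequence, so a Wiener integral is a pointwise limit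
of functionals. This makes it accessible to shifts and to dominated convergence. -/
lemma exists_seq_tendsto (hW : IsAbstractWienerSpace ι μ) (h : H) :
    ∃ ℓ : ℕ → StrongDual ℝ X, Tendsto (fun n => dualVec ι (ℓ n)) atTop (𝓝 h) ∧
      ∀ᵐ x ∂μ, Tendsto (fun n => ℓ n x) atTop (𝓝 (wienerMap ι μ h x)) := by
  obtain ⟨u, hu, hlim⟩ := mem_closure_iff_seq_limit.1 (denseRange_dualVec hW.injective h)
  choose ℓ hℓ using hu
  have h1 : Tendsto (fun n => StrongDual.toLp μ 2 (ℓ n)) atTop (𝓝 (wienerMap ι μ h)) := by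
    refine (((wienerMap ι μ).continuous.tendsto h).comp hlim).congr fun n => ?_
    rw [Function.comp_apply, ← hℓ, hW.wienerMap_dualVec]
  obtain ⟨ns, hns, hae⟩ := (tendstoInMeasure_of_tendsto_Lp h1).exists_seq_tendsto_ae
  refine ⟨fun n => ℓ (ns n), ?_, ?_⟩
  · simp only [hℓ]
    exact hlim.comp hns.tendsto_atTop
  · filter_upwards [hae, ae_all_iff.2 fun n => hW.coeFn_toLp (ℓ (ns n))] with x hx hx'
    exact hx.congr fun n => hx' n

lemma map_dual_eq_gaussianReal (hW : IsAbstractWienerSpace ι μ) (ℓ : StrongDual ℝ X) :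
    μ.map ℓ = gaussianReal 0 (‖dualVec ι ℓ‖₊ ^ 2) := by
  have := hW.isGaussian
  rw [IsGaussian.map_eq_gaussianReal ℓ, hW.centered]
  congr 1
  rw [variance_of_integral_eq_zero (by fun_prop) (hW.centered ℓ), hW.covariance, ← norm_dualVec,
    Real.toNNReal_pow (norm_nonneg _), norm_toNNReal]

lemma map_wienerMap (hW : IsAbstractWienerSpace ι μ) (h : H) :
    μ.map (wienerMap ι μ h) = gaussianReal 0 (‖h‖₊ ^ 2) := by
  have := hW.isGaussian
  obtain ⟨ℓ, hℓ, hae⟩ := hW.exists_seq_tendsto h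
  have hm : AEMeasurable (wienerMap ι μ h) μ := (Lp.aestronglyMeasurable _).aemeasurable
  have := Measure.isProbabilityMeasure_map hm
  apply Measure.ext_of_charFun
  ext t
  have h1 : Tendsto (fun n => charFun (μ.map (ℓ n)) t) atTop
      (𝓝 (charFun (μ.map (wienerMap ι μ h)) t)) := by
    simp only [charFun_apply_real]
    rw [integral_map hm (by fun_prop)]
    simp_rw [integral_map (ℓ _).continuous.measurable.aemeasurable
      (show AEStronglyMeasurable (fun y : ℝ => Complex.exp (t * y * Complex.I)) _ by fun_prop)]
    refine tendsto_integral_of_dominated_convergence (fun _ => 1) (fun n => ?_)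
      (integrable_const _) (fun n => .of_forall fun x => ?_) ?_
    · exact Continuous.aestronglyMeasurable (by fun_prop)
    · rw [← Complex.ofReal_mul, Complex.norm_exp_ofReal_mul_I]
    · filter_upwards [hae] with x hx
      have hc : Continuous fun y : ℝ => Complex.exp (t * y * Complex.I) := by fun_prop
      exact (hc.tendsto _).comp hx
  have h2 : Tendsto (fun n => charFun (μ.map (ℓ n)) t) atTop
      (𝓝 (charFun (gaussianReal 0 (‖h‖₊ ^ 2)) t)) := by
    simp only [hW.map_dual_eq_gaussianReal, charFun_gaussianReal]
    have hc : Continuous fun y : H => Complex.exp (t * ((0 : ℝ) : ℂ) * Complex.I -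
      ((‖y‖₊ ^ 2 : NNReal) : ℝ) * t ^ 2 / 2) := by fun_prop
    exact (hc.tendsto _).comp hℓ
  exact tendsto_nhds_unique h1 h2

lemma integral_mul_dual (hW : IsAbstractWienerSpace ι μ) (ℓ m : StrongDual ℝ X) :
    ∫ x, ℓ x * m x ∂μ = inner ℝ (dualVec ι ℓ) (dualVec ι m) := by
  have := hW.isGaussian
  have h := hW.covariance (ℓ + m)
  have i1 := (IsGaussian.memLp_dual μ ℓ 2 (by simp)).integrable_sq
  have i2 := (IsGaussian.memLp_dual μ m 2 (by simp)).integrable_sq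
  have i3 : Integrable (fun x => ℓ x * m x) μ :=
    (IsGaussian.memLp_dual μ ℓ 2 (by simp)).integrable_mul (IsGaussian.memLp_dual μ m 2 (by simp))
  have e : ∀ x, (ℓ + m) x ^ 2 = ℓ x ^ 2 + 2 * (ℓ x * m x) + m x ^ 2 := fun x => by
    rw [add_apply]; ring
  simp_rw [e] at h
  rw [integral_add (show Integrable (fun x => ℓ x ^ 2 + 2 * (ℓ x * m x)) μ from
      i1.add (i3.const_mul 2)) i2, integral_add i1 (i3.const_mul 2),
    integral_const_mul, hW.covariance, hW.covariance, ← norm_dualVec, ← norm_dualVec,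
    ← norm_dualVec, map_add, norm_add_sq_real] at h
  linarith

lemma cov_dual (hW : IsAbstractWienerSpace ι μ) (ℓ m : StrongDual ℝ X) :
    cov[ℓ, m; μ] = inner ℝ (dualVec ι ℓ) (dualVec ι m) := by
  have := hW.isGaussian
  rw [covariance_eq_sub (IsGaussian.memLp_dual μ ℓ 2 (by simp))
    (IsGaussian.memLp_dual μ m 2 (by simp)), hW.centered, zero_mul, sub_zero]
  exact hW.integral_mul_dual ℓ m

/-- A function that is almost everywhere invariant under Cameron-Martin shifts is independent of
every continuous functional. -/
lemma indepFun_of_shift_invariant (hW : IsAbstractWienerSpace ι μ) {E : Set X}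
    (hE : ∀ᵐ x ∂μ, x ∈ E) {f : X → ℝ} (hf : Measurable f)
    (hinv : ∀ x ∈ E, ∀ h, f (x + ι h) = f x) (ℓ : StrongDual ℝ X) : IndepFun f ℓ μ := by
  have := hW.isGaussian
  set h : H := dualVec ι ℓ with hh
  -- `P` removes the component along `ι h`, so `P (ι h) = 0` and `P` is uncorrelated with `ℓ`, hence
  -- independent of it by joint Gaussianity. If `h = 0`, the inverse is 0 and `P` is the identity.
  let P : X →L[ℝ] X := ContinuousLinearMap.id ℝ X - (‖h‖ ^ 2)⁻¹ • ℓ.smulRight (ι h)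
  have hP : ∀ x, P x = x + ι (-((‖h‖ ^ 2)⁻¹ * ℓ x) • h) := fun x => by
    simp only [P, sub_apply, ContinuousLinearMap.id_apply,
      smul_apply, ContinuousLinearMap.smulRight_apply, map_smul]
    module
  have hind : IndepFun P ℓ μ := by
    refine HasGaussianLaw.indepFun_of_covariance_strongDual (X := P) (Y := ℓ)
      (IsGaussian.hasGaussianLaw_id.map (P.prod ℓ)) fun L₁ L₂ => ?_
    have e := hW.cov_dual (L₁.comp P) (L₂.comp ℓ)
    rw [ContinuousLinearMap.coe_comp, ContinuousLinearMap.coe_comp] at e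
    rw [e]
    have e1 : dualVec ι (L₂.comp ℓ) = L₂ 1 • h := by
      rw [hh, ← map_smul]
      congr 1
      ext x
      have := L₂.map_smul (ℓ x) 1
      simp only [smul_eq_mul, mul_one] at this
      simp [this, mul_comm]
    rw [e1, real_inner_smul_right, inner_dualVec, ContinuousLinearMap.comp_apply, hP]
    have e2 : ℓ (ι h) = ‖h‖ ^ 2 := by rw [← inner_dualVec, ← hh, real_inner_self_eq_norm_sq]
    rcases eq_or_ne h 0 with h0 | h0
    · simp [h0]
    · have : ‖h‖ ≠ 0 := norm_ne_zero_iff.2 h0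
      rw [e2, inv_mul_cancel₀ (by positivity)]
      simp
  refine (hind.comp hf measurable_id).congr ?_ .rfl
  filter_upwards [hE] with x hx
  rw [Function.comp_apply, hP, hinv x hx]

/-- A function that is independent of every continuous functional is almost everywhere constant:
its level events have measure zero or one. -/
lemma measure_preimage_eq_zero_or_one (hW : IsAbstractWienerSpace ι μ) {f : X → ℝ}
    (hf : Measurable f) (hind : ∀ ℓ : StrongDual ℝ X, IndepFun f ℓ μ) {s : Set ℝ}
    (hs : MeasurableSet s) : μ (f ⁻¹' s) = 0 ∨ μ (f ⁻¹' s) = 1 := by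
  have := hW.isGaussian
  set A := f ⁻¹' s with hA
  have hAm : MeasurableSet A := hf hs
  have : IsFiniteMeasure (μ A • μ) := μ.smul_finite (measure_ne_top _ _)
  have key : μ.restrict A = μ A • μ := by
    apply Measure.ext_of_charFunDual
    ext ℓ
    rw [charFunDual_eq_charFun_map_one, charFunDual_eq_charFun_map_one]
    -- Independence makes the images under `ℓ` of the two measures equal, so their characteristic
    -- functionals agree. Evaluating both at `A` then gives $\mu(A) = \mu(A)^2$.
    congr 1
    ext t ht
    have hℓ : Measurable ℓ := ℓ.continuous.measurable
    rw [Measure.map_apply hℓ ht, Measure.map_apply hℓ ht, Measure.restrict_apply (hℓ ht),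
      Set.inter_comm, hA, (hind ℓ).measure_inter_preimage_eq_mul s t hs ht, Measure.smul_apply,
      smul_eq_mul]
  have h2 := congrArg (fun ν => ν A) key
  simp only [Measure.restrict_apply_self, Measure.smul_apply, smul_eq_mul] at h2
  rcases eq_or_ne (μ A) 0 with h0 | h0
  · exact Or.inl h0
  · refine Or.inr ?_
    have h3 := congrArg ENNReal.toReal h2
    have h4 : (μ A).toReal ≠ 0 := ENNReal.toReal_ne_zero.2 ⟨h0, measure_ne_top _ _⟩
    rw [ENNReal.toReal_mul] at h3
    have h5 : (μ A).toReal = 1 := by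
      apply mul_left_cancel₀ h4; rw [← h3, mul_one]
    rw [← ENNReal.ofReal_toReal (measure_ne_top μ A), h5, ENNReal.ofReal_one]

lemma map_neg_eq (hW : IsAbstractWienerSpace ι μ) : μ.map (fun x => -x) = μ := by
  have := hW.isGaussian
  have hn : Measurable fun x : X => -x := measurable_neg
  have := Measure.isProbabilityMeasure_map (μ := μ) hn.aemeasurable
  apply Measure.ext_of_charFunDual
  ext ℓ
  rw [charFunDual_eq_charFun_map_one, charFunDual_eq_charFun_map_one,
    Measure.map_map ℓ.continuous.measurable hn]
  have : ℓ ∘ (fun x => -x) = (-ℓ : StrongDual ℝ X) := by ext x; simp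
  rw [this, hW.map_dual_eq_gaussianReal, hW.map_dual_eq_gaussianReal, map_neg, nnnorm_neg]

/-- An odd measurable function that is invariant under Cameron-Martin shifts on a set of full
measure vanishes almost everywhere. -/
lemma ae_eq_zero_of_shift_invariant_of_odd (hW : IsAbstractWienerSpace ι μ) {E : Set X}
    (hE : ∀ᵐ x ∂μ, x ∈ E) {f : X → ℝ} (hf : Measurable f)
    (hinv : ∀ x ∈ E, ∀ h, f (x + ι h) = f x) (hodd : ∀ x ∈ E, f (-x) = -f x) :
    f =ᵐ[μ] 0 := by
  have := hW.isGaussian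
  have h01 : ∀ s : Set ℝ, MeasurableSet s → μ (f ⁻¹' s) = 0 ∨ μ (f ⁻¹' s) = 1 := fun s hs =>
    hW.measure_preimage_eq_zero_or_one hf (hW.indepFun_of_shift_invariant hE hf hinv) hs
  -- Symmetry of $\mu$ gives these disjoint events the same measure, so neither can have measure
  -- one.
  have hsymm : μ (f ⁻¹' Set.Ioi 0) = μ (f ⁻¹' Set.Iio 0) := by
    conv_lhs => rw [← hW.map_neg_eq, Measure.map_apply measurable_neg (hf measurableSet_Ioi)]
    refine measure_congr ?_
    filter_upwards [hE] with x hx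
    change (0 < f (-x)) = (f x < 0)
    rw [hodd x hx, neg_pos]
  have hdisj : μ (f ⁻¹' Set.Ioi 0) + μ (f ⁻¹' Set.Iio 0) ≤ 1 := by
    rw [← measure_union _ (hf measurableSet_Iio)]
    · exact prob_le_one
    · refine Disjoint.preimage f ?_
      rw [Set.disjoint_left]
      intro y h1 h2
      exact lt_asymm (Set.mem_Ioi.1 h1) (Set.mem_Iio.1 h2)
  have h0 : μ (f ⁻¹' Set.Ioi 0) = 0 := by
    rcases h01 _ measurableSet_Ioi with h | h
    · exact h
    · rw [← hsymm, h] at hdisj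
      norm_num at hdisj
  have h0' : μ (f ⁻¹' Set.Iio 0) = 0 := hsymm ▸ h0
  have := measure_union_null h0 h0'
  rw [Filter.EventuallyEq, ae_iff]
  convert this using 2
  ext x
  simp only [Pi.zero_apply, Set.mem_ofPred_eq, Set.mem_union, Set.mem_preimage, Set.mem_Ioi,
    Set.mem_Iio]
  rw [or_comm]; exact ne_iff_lt_or_gt

variable {S : H →L[ℝ] H} {T : X → X}

/-- The linear functional `ℓ ∘ T` is the Wiener integral of `S* ι* ℓ`. -/
lemma dual_comp_ae_eq (hW : IsAbstractWienerSpace ι μ) (hT : IsAELinearExtension ι μ S T)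
    (ℓ : StrongDual ℝ X) :
    (fun x => ℓ (T x)) =ᵐ[μ]
      wienerMap ι μ (ContinuousLinearMap.adjoint S (dualVec ι ℓ)) := by
  set k := ContinuousLinearMap.adjoint S (dualVec ι ℓ) with hk
  obtain ⟨m, hm, hae⟩ := hW.exists_seq_tendsto k
  obtain ⟨E, -, hE, ⟨L, hL⟩, hι⟩ := hT.linear_extends
  let F : Set X := {x | x ∈ E ∧ ∃ a, Tendsto (fun n => m n x) atTop (𝓝 a)}
  -- The `limsup` is an everywhere defined measurable version of $Wk$; on `F` it is a genuine limit,
  -- so it is additive under shifts and odd there.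
  let f : X → ℝ := fun x => ℓ (T x) - limsup (fun n => m n x) atTop
  have hf : Measurable f :=
    (ℓ.continuous.measurable.comp hT.measurable).sub
      (Measurable.limsup fun n => (m n).continuous.measurable)
  have hTadd : ∀ x ∈ E, ∀ y ∈ E, T (x + y) = T x + T y := fun x hx y hy => by
    have h1 := hL ⟨x + y, E.add_mem hx hy⟩
    have h2 := hL ⟨x, hx⟩
    have h3 := hL ⟨y, hy⟩
    simp only at h1 h2 h3
    rw [h1, h2, h3, ← map_add]; rfl
  have hTneg : ∀ x ∈ E, T (-x) = -T x := fun x hx => by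
    have h1 := hL ⟨-x, E.neg_mem hx⟩
    have h2 := hL ⟨x, hx⟩
    simp only at h1 h2
    rw [h1, h2, ← map_neg]; rfl
  have hF : ∀ᵐ x ∂μ, x ∈ F := by
    filter_upwards [hE, hae] with x h1 h2
    exact ⟨h1, _, h2⟩
  have h0 : f =ᵐ[μ] 0 := by
    refine hW.ae_eq_zero_of_shift_invariant_of_odd hF hf ?_ ?_
    · rintro x ⟨hx, a, ha⟩ h
      have h1 : Tendsto (fun n => m n (ι h)) atTop (𝓝 (inner ℝ k h)) := by
        simp only [← inner_dualVec]
        exact hm.inner tendsto_const_nhds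
      have h2 : Tendsto (fun n => m n (x + ι h)) atTop (𝓝 (a + inner ℝ k h)) := by
        simpa only [map_add] using ha.add h1
      simp only [f]
      -- Both terms grow by the same amount, $\langle \iota^*\ell, Sh\rangle = \langle
      -- S^*\iota^*\ell, h\rangle$.
      rw [h2.limsup_eq, ha.limsup_eq, hTadd x hx _ (hι h).1, (hι h).2, map_add, ← inner_dualVec,
        hk, ContinuousLinearMap.adjoint_inner_left]
      ring
    · rintro x ⟨hx, a, ha⟩
      have h2 : Tendsto (fun n => m n (-x)) atTop (𝓝 (-a)) := by
        simpa only [map_neg] using ha.neg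
      simp only [f]
      rw [h2.limsup_eq, ha.limsup_eq, hTneg x hx, map_neg]
      ring
  filter_upwards [h0, hae] with x h1 h2
  have h3 : ℓ (T x) - limsup (fun n => m n x) atTop = 0 := h1
  rw [h2.limsup_eq] at h3
  linarith

/-- The law of $\ell\circ T$ is centred Gaussian of variance $\|S^*\iota^*\ell\|^2 =
\|\iota^*\ell\|^2$, the same as that of $\ell$; these laws determine the measure. -/
lemma measurePreserving (hW : IsAbstractWienerSpace ι μ)
    (hS : S ∘L ContinuousLinearMap.adjoint S = ContinuousLinearMap.id ℝ H)
    (hT : IsAELinearExtension ι μ S T) : MeasurePreserving T μ μ := by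
  have := hW.isGaussian
  have := Measure.isProbabilityMeasure_map (μ := μ) hT.measurable.aemeasurable
  refine ⟨hT.measurable, ?_⟩
  apply Measure.ext_of_charFunDual
  ext ℓ
  rw [charFunDual_eq_charFun_map_one, charFunDual_eq_charFun_map_one,
    Measure.map_map ℓ.continuous.measurable hT.measurable,
    Measure.map_congr (show ℓ ∘ T =ᵐ[μ] _ from hW.dual_comp_ae_eq hT ℓ), hW.map_wienerMap,
    hW.map_dual_eq_gaussianReal]
  have : ‖ContinuousLinearMap.adjoint S (dualVec ι ℓ)‖₊ = ‖dualVec ι ℓ‖₊ :=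
    NNReal.eq (norm_adjoint_apply_of_comp_adjoint hS _)
  rw [this]

end IsAbstractWienerSpace

/-- The Koopman operator of a measure preserving map. -/
noncomputable def koopman {α : Type*} [MeasurableSpace α] {m : Measure α} {T : α → α}
    (hT : MeasurePreserving T m m) : Lp ℝ 2 m →L[ℝ] Lp ℝ 2 m :=
  (Lp.compMeasurePreservingₗᵢ ℝ T hT).toContinuousLinearMap

lemma koopman_coeFn {α : Type*} [MeasurableSpace α] {m : Measure α} {T : α → α}
    (hT : MeasurePreserving T m m) (f : Lp ℝ 2 m) : koopman hT f =ᵐ[m] f ∘ T :=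
  Lp.coeFn_compMeasurePreserving f hT

lemma norm_koopman_apply {α : Type*} [MeasurableSpace α] {m : Measure α} {T : α → α}
    (hT : MeasurePreserving T m m) (f : Lp ℝ 2 m) : ‖koopman hT f‖ = ‖f‖ :=
  LinearIsometry.norm_map _ _

lemma IsAbstractWienerSpace.koopman_wienerMap {S : H →L[ℝ] H} {T : X → X}
    (hW : IsAbstractWienerSpace ι μ) (hT : IsAELinearExtension ι μ S T)
    (hmp : MeasurePreserving T μ μ) (h : H) :
    koopman hmp (wienerMap ι μ h) = wienerMap ι μ (ContinuousLinearMap.adjoint S h) := by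
  refine (denseRange_dualVec hW.injective).induction_on h ?_ fun ℓ => ?_
  · exact isClosed_eq (by fun_prop) (by fun_prop)
  · rw [hW.wienerMap_dualVec]
    apply Lp.ext
    filter_upwards [koopman_coeFn hmp (StrongDual.toLp μ 2 ℓ), hW.dual_comp_ae_eq hT ℓ,
      hmp.quasiMeasurePreserving.ae (hW.coeFn_toLp ℓ)] with x h1 h2 h3
    rw [h1, ← h2, Function.comp_apply, h3]

end Wiener

/-! ### Exponential vectors -/

lemma Real.inner_eq_mul (a b : ℝ) : inner ℝ a b = a * b := by
  simp [mul_comm]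

section ExpVec

variable {X H : Type*} [NormedAddCommGroup X] [NormedSpace ℝ X] [CompleteSpace X]
  [SecondCountableTopology X] [MeasurableSpace X] [BorelSpace X]
  [NormedAddCommGroup H] [InnerProductSpace ℝ H] [CompleteSpace H]
  {ι : H →L[ℝ] X} {μ : Measure X}

namespace IsAbstractWienerSpace

lemma integrable_exp_mul_wienerMap (hW : IsAbstractWienerSpace ι μ) (h : H) (t : ℝ) :
    Integrable (fun x => Real.exp (t * wienerMap ι μ h x)) μ := by
  have hm : AEMeasurable (wienerMap ι μ h) μ := (Lp.aestronglyMeasurable _).aemeasurable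
  have h1 : Integrable (fun y : ℝ => Real.exp (t * y)) (μ.map (wienerMap ι μ h)) := by
    rw [hW.map_wienerMap]
    exact integrable_exp_mul_gaussianReal t
  exact (integrable_map_measure (by fun_prop) hm).1 h1

lemma integral_exp_wienerMap (hW : IsAbstractWienerSpace ι μ) (h : H) :
    ∫ x, Real.exp (wienerMap ι μ h x) ∂μ = Real.exp (‖h‖ ^ 2 / 2) := by
  have := mgf_gaussianReal (hW.map_wienerMap h) 1
  simpa [mgf] using this

lemma memLp_exp (hW : IsAbstractWienerSpace ι μ) (h : H) :
    MemLp (fun x => Real.exp (wienerMap ι μ h x - ‖h‖ ^ 2 / 2)) 2 μ := by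
  have hm : AEStronglyMeasurable (wienerMap ι μ h) μ := Lp.aestronglyMeasurable _
  rw [memLp_two_iff_integrable_sq (by fun_prop)]
  refine ((hW.integrable_exp_mul_wienerMap h 2).mul_const (Real.exp (-‖h‖ ^ 2))).congr
    (.of_forall fun x => ?_)
  simp only
  rw [← Real.exp_add, ← Real.exp_nat_mul]
  congr 1
  push_cast
  ring

/-- The normalised exponential `exp (W h - ‖h‖² / 2)`, as an element of `L²(μ)`. -/
noncomputable def expVec (hW : IsAbstractWienerSpace ι μ) (h : H) : Lp ℝ 2 μ :=
  (hW.memLp_exp h).toLp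

lemma coeFn_expVec (hW : IsAbstractWienerSpace ι μ) (h : H) :
    hW.expVec h =ᵐ[μ] fun x => Real.exp (wienerMap ι μ h x - ‖h‖ ^ 2 / 2) :=
  MemLp.coeFn_toLp _

lemma inner_expVec (hW : IsAbstractWienerSpace ι μ) (h k : H) :
    inner ℝ (hW.expVec h) (hW.expVec k) = Real.exp (inner ℝ h k) := by
  have e : (fun x => inner ℝ (hW.expVec h x) (hW.expVec k x)) =ᵐ[μ]
      fun x => Real.exp (-(‖h‖ ^ 2 + ‖k‖ ^ 2) / 2) * Real.exp (wienerMap ι μ (h + k) x) := by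
    have hadd : wienerMap ι μ (h + k) =ᵐ[μ] wienerMap ι μ h + wienerMap ι μ k := by
      rw [map_add]; exact Lp.coeFn_add _ _
    filter_upwards [hW.coeFn_expVec h, hW.coeFn_expVec k, hadd] with x h1 h2 h3
    rw [h1, h2, h3, Real.inner_eq_mul, ← Real.exp_add, ← Real.exp_add, Pi.add_apply]
    congr 1
    ring
  rw [L2.inner_def, integral_congr_ae e, integral_const_mul, hW.integral_exp_wienerMap,
    ← Real.exp_add, norm_add_sq_real]
  congr 1
  ring

lemma coeFn_expVec_zero (hW : IsAbstractWienerSpace ι μ) : hW.expVec 0 =ᵐ[μ] fun _ => 1 := by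
  have h0 : wienerMap ι μ 0 =ᵐ[μ] 0 := by rw [map_zero]; exact Lp.coeFn_zero _ _ _
  filter_upwards [hW.coeFn_expVec 0, h0] with x h1 h2
  rw [h1, h2]; simp

/-- The normalising constant survives because $S^*$ preserves norms. -/
lemma koopman_expVec {S : H →L[ℝ] H} {T : X → X} (hW : IsAbstractWienerSpace ι μ)
    (hS : S ∘L ContinuousLinearMap.adjoint S = ContinuousLinearMap.id ℝ H)
    (hT : IsAELinearExtension ι μ S T) (hmp : MeasurePreserving T μ μ) (h : H) :
    koopman hmp (hW.expVec h) = hW.expVec (ContinuousLinearMap.adjoint S h) := by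
  apply Lp.ext
  have e := koopman_coeFn hmp (wienerMap ι μ h)
  rw [hW.koopman_wienerMap hT] at e
  filter_upwards [koopman_coeFn hmp (hW.expVec h), e,
    hmp.quasiMeasurePreserving.ae (hW.coeFn_expVec h),
    hW.coeFn_expVec (ContinuousLinearMap.adjoint S h)] with x h1 h2 h3 h4
  rw [h1, h4, Function.comp_apply, h3, h2, norm_adjoint_apply_of_comp_adjoint hS,
    Function.comp_apply]

/-- Orthogonality says that $g^+\mu$ and $g^-\mu$ have the same Laplace transform along every
functional. These transforms are finite everywhere, so they continue analytically to the imaginary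
axis, where they are characteristic functionals; hence $g^+ = g^-$ a.e. -/
lemma eq_zero_of_inner_expVec_eq_zero (hW : IsAbstractWienerSpace ι μ) {g : Lp ℝ 2 μ}
    (hg : ∀ h, inner ℝ (hW.expVec h) g = 0) : g = 0 := by
  have := hW.isGaussian
  have hgm : Measurable g := (Lp.stronglyMeasurable g).measurable
  have hgi : Integrable g μ := (Lp.memLp g).integrable one_le_two
  have hexp : ∀ (ℓ : StrongDual ℝ X) (t : ℝ), MemLp (fun x => Real.exp (t * ℓ x)) 2 μ := by
    intro ℓ t
    rw [memLp_two_iff_integrable_sq (Continuous.aestronglyMeasurable (by fun_prop))]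
    have h1 : Integrable (fun y : ℝ => Real.exp (2 * t * y)) (μ.map ℓ) := by
      rw [hW.map_dual_eq_gaussianReal]
      exact integrable_exp_mul_gaussianReal _
    refine ((integrable_map_measure (by fun_prop)
      ℓ.continuous.measurable.aemeasurable).1 h1).congr (.of_forall fun x => ?_)
    simp only [Function.comp_apply]
    rw [← Real.exp_nat_mul]
    congr 1
    push_cast
    ring
  have hint : ∀ (ℓ : StrongDual ℝ X) (t : ℝ), ∫ x, g x * Real.exp (t * ℓ x) ∂μ = 0 := by
    intro ℓ t
    have h1 := hg (dualVec ι (t • ℓ))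
    rw [L2.inner_def] at h1
    have e : (fun x => inner ℝ (hW.expVec (dualVec ι (t • ℓ)) x) (g x)) =ᵐ[μ]
        fun x => Real.exp (-‖dualVec ι (t • ℓ)‖ ^ 2 / 2) * (g x * Real.exp (t * ℓ x)) := by
      have h2 := hW.coeFn_toLp (t • ℓ)
      rw [← hW.wienerMap_dualVec] at h2
      filter_upwards [hW.coeFn_expVec (dualVec ι (t • ℓ)), h2] with x h3 h4
      rw [h3, h4, Real.inner_eq_mul, sub_eq_add_neg, Real.exp_add, smul_apply,
        smul_eq_mul, neg_div]
      ring
    rw [integral_congr_ae e, integral_const_mul] at h1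
    exact (mul_eq_zero.1 h1).resolve_left (Real.exp_ne_zero _)
  -- `ν 1` and `ν (-1)` have densities $g^+$ and $g^-$, as `ENNReal.ofReal` truncates at zero.
  let ν : ℝ → Measure X := fun s => μ.withDensity fun x => ENNReal.ofReal (s * g x)
  have hmeas : ∀ s : ℝ, Measurable fun x => ENNReal.ofReal (s * g x) := fun s =>
    (hgm.const_mul s).ennreal_ofReal
  have hfin : ∀ s, IsFiniteMeasure (ν s) := fun s =>
    isFiniteMeasure_withDensity_ofReal (hgi.const_mul s).2
  have hmax : ∀ s : ℝ, MemLp (fun x => max (s * g x) 0) 2 μ := fun s =>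
    ((Lp.memLp g).const_mul s).pos_part
  have hi : ∀ (s : ℝ) (ℓ : StrongDual ℝ X) (t : ℝ),
      Integrable (fun x => max (s * g x) 0 * Real.exp (t * ℓ x)) μ := fun s ℓ t =>
    (hmax s).integrable_mul (hexp ℓ t)
  have hset : ∀ (s : ℝ) (ℓ : StrongDual ℝ X), integrableExpSet ℓ (ν s) = Set.univ := by
    intro s ℓ
    ext t
    simp only [integrableExpSet, Set.mem_ofPred_eq, Set.mem_univ, iff_true]
    rw [integrable_withDensity_iff_integrable_smul' (hmeas s) (by simp)]
    simpa only [ENNReal.toReal_ofReal', smul_eq_mul] using hi s ℓ t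
  have hmgf : ∀ ℓ : StrongDual ℝ X, mgf ℓ (ν 1) = mgf ℓ (ν (-1)) := by
    intro ℓ
    ext t
    rw [mgf, mgf, integral_withDensity_eq_integral_toReal_smul (hmeas _) (by simp),
      integral_withDensity_eq_integral_toReal_smul (hmeas _) (by simp)]
    simp only [ENNReal.toReal_ofReal', smul_eq_mul]
    rw [← sub_eq_zero, ← integral_sub (hi 1 ℓ t) (hi (-1) ℓ t)]
    refine Eq.trans ?_ (hint ℓ t)
    refine integral_congr_ae (.of_forall fun x => ?_)
    simp only [one_mul, neg_mul]
    rw [← sub_mul]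
    congr 1
    rcases le_total 0 (g x) with h | h
    · rw [max_eq_left h, max_eq_right (by linarith), sub_zero]
    · rw [max_eq_right h, max_eq_left (by linarith), zero_sub, neg_neg]
  have hzero : ν 1 = 0 ↔ ν (-1) = 0 := by
    have h0 := congrFun (hmgf 0) 0
    simp only [mgf, zero_mul, Real.exp_zero, integral_const, smul_eq_mul, mul_one] at h0
    rw [← Measure.measure_univ_eq_zero, ← Measure.measure_univ_eq_zero,
      ← measureReal_eq_zero_iff, ← measureReal_eq_zero_iff, h0]
  have heq : ν 1 = ν (-1) := by
    apply Measure.ext_of_charFunDual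
    ext ℓ
    have h1 := eqOn_complexMGF_of_mgf' (hmgf ℓ) hzero (x := Complex.I) (by simp [hset])
    simpa only [charFunDual_apply, complexMGF, mul_comm Complex.I] using h1
  have hlint : ∫⁻ x, ENNReal.ofReal (1 * g x) ∂μ ≠ ⊤ := by
    have := measure_ne_top (ν 1) Set.univ
    rwa [withDensity_apply _ .univ, Measure.restrict_univ] at this
  have h2 := (withDensity_eq_iff (hmeas 1).aemeasurable (hmeas (-1)).aemeasurable hlint).1 heq
  apply Lp.ext
  filter_upwards [h2, Lp.coeFn_zero ℝ 2 μ] with x h3 h4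
  rw [h4, Pi.zero_apply]
  have h5 := congrArg ENNReal.toReal h3
  simp only [ENNReal.toReal_ofReal', one_mul, neg_mul] at h5
  rcases le_total 0 (g x) with h | h
  · rw [max_eq_left h, max_eq_right (by linarith)] at h5; exact h5
  · rw [max_eq_right h, max_eq_left (by linarith)] at h5; linarith

lemma dense_span_expVec (hW : IsAbstractWienerSpace ι μ) :
    Dense (Submodule.span ℝ (Set.range hW.expVec) : Set (Lp ℝ 2 μ)) := by
  rw [Submodule.dense_iff_topologicalClosure_eq_top, Submodule.topologicalClosure_eq_top_iff,
    Submodule.eq_bot_iff]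
  intro g hg
  exact hW.eq_zero_of_inner_expVec_eq_zero fun h =>
    Submodule.inner_right_of_mem_orthogonal (Submodule.subset_span (Set.mem_range_self h)) hg

end IsAbstractWienerSpace

end ExpVec

/-! ### Correlations -/

section Correlation

variable {L : Type*} [NormedAddCommGroup L] [InnerProductSpace ℝ L]

/-- The centred correlation form `⟨K f, g⟩ - ⟨f, e⟩ ⟨g, e⟩`. -/
noncomputable def corrForm (K : L →L[ℝ] L) (hK : ∀ f, ‖K f‖ = ‖f‖) (e : L) (he : ‖e‖ = 1) :
    L →L[ℝ] L →L[ℝ] ℝ :=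
  LinearMap.mkContinuous₂
    (LinearMap.mk₂ ℝ (fun f g => inner ℝ (K f) g - inner ℝ e f * inner ℝ e g)
      (fun f f' g => by simp only [map_add, inner_add_left, inner_add_right]; ring)
      (fun c f g => by
        simp only [map_smul, real_inner_smul_left, real_inner_smul_right, smul_eq_mul]; ring)
      (fun f g g' => by simp only [inner_add_right]; ring)
      (fun c f g => by simp only [real_inner_smul_right, smul_eq_mul]; ring)) 2
    fun f g => by
      simp only [LinearMap.mk₂_apply]
      have h1 := norm_inner_le_norm (𝕜 := ℝ) (K f) g
      have h2 := norm_inner_le_norm (𝕜 := ℝ) e f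
      have h3 := norm_inner_le_norm (𝕜 := ℝ) e g
      rw [hK] at h1
      rw [he, one_mul] at h2 h3
      calc _ ≤ ‖inner ℝ (K f) g‖ + ‖inner ℝ e f * inner ℝ e g‖ := norm_sub_le _ _
        _ ≤ ‖f‖ * ‖g‖ + ‖f‖ * ‖g‖ := by
          rw [norm_mul]
          gcongr
        _ = 2 * ‖f‖ * ‖g‖ := by ring

lemma norm_corrForm_le (K : L →L[ℝ] L) (hK : ∀ f, ‖K f‖ = ‖f‖) (e : L) (he : ‖e‖ = 1) :
    ‖corrForm K hK e he‖ ≤ 2 :=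
  LinearMap.mkContinuous₂_norm_le _ zero_le_two _

lemma IsNullNotion.correlation_of_dense {N : (ℕ → ℝ) → Prop} (hN : IsNullNotion N)
    {K : L →L[ℝ] L} (hK : ∀ f, ‖K f‖ = ‖f‖) {e : L} (he : ‖e‖ = 1) {s : Set L}
    (hs : Dense (Submodule.span ℝ s : Set L))
    (h : ∀ f ∈ s, ∀ g ∈ s, N fun j => inner ℝ ((K ^ j) f) g - inner ℝ e f * inner ℝ e g)
    (f g : L) : N fun j => inner ℝ ((K ^ j) f) g - inner ℝ e f * inner ℝ e g :=
  hN.of_dense₂ (fun j => corrForm (K ^ j) (norm_pow_apply hK j) e he)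
    (fun _ => norm_corrForm_le _ _ _ _) hs hs h f g

end Correlation

section Indicator

variable {α : Type*} [MeasurableSpace α] {m : Measure α} [IsProbabilityMeasure m]

/-- The indicator function of a measurable set, as an element of `L²`. -/
noncomputable def indLp (m : Measure α) [IsProbabilityMeasure m] {A : Set α}
    (hA : MeasurableSet A) : Lp ℝ 2 m :=
  indicatorConstLp 2 hA (measure_ne_top m A) 1

lemma coeFn_indLp {A : Set α} (hA : MeasurableSet A) :
    indLp m hA =ᵐ[m] A.indicator fun _ => 1 :=
  indicatorConstLp_coeFn

lemma inner_indLp {A B : Set α} (hA : MeasurableSet A) (hB : MeasurableSet B) :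
    inner ℝ (indLp m hA) (indLp m hB) = m.real (A ∩ B) := by
  rw [indLp, L2.inner_indicatorConstLp_one, setIntegral_congr_ae hA
    (g := B.indicator fun _ => (1 : ℝ)) ((coeFn_indLp hB).mono fun x hx _ => hx),
    setIntegral_indicator hB]
  simp

lemma norm_indLp_univ : ‖indLp m (MeasurableSet.univ : MeasurableSet (Set.univ : Set α))‖ = 1 := by
  have h := inner_indLp (m := m) (MeasurableSet.univ (α := α)) MeasurableSet.univ
  rw [real_inner_self_eq_norm_sq, Set.inter_self, probReal_univ] at h
  exact (pow_eq_one_iff_of_nonneg (norm_nonneg _) two_ne_zero).1 h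

lemma dense_span_indLp : Dense (Submodule.span ℝ
    {f : Lp ℝ 2 m | ∃ (A : Set α) (hA : MeasurableSet A), f = indLp m hA} : Set (Lp ℝ 2 m)) := by
  set s := {f : Lp ℝ 2 m | ∃ (A : Set α) (hA : MeasurableSet A), f = indLp m hA}
  rw [Submodule.dense_iff_topologicalClosure_eq_top, eq_top_iff]
  rintro f -
  refine Lp.induction (by simp) (fun f => f ∈ (Submodule.span ℝ s).topologicalClosure) ?_ ?_ ?_ f
  · intro c A hA hμA
    rw [Lp.simpleFunc.coe_indicatorConst]
    have : indicatorConstLp 2 hA hμA.ne c = c • indLp m hA := by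
      apply Lp.ext
      filter_upwards [indicatorConstLp_coeFn (p := 2) (hs := hA) (hμs := hμA.ne) (c := c),
        Lp.coeFn_smul c (indLp m hA), coeFn_indLp (m := m) hA] with x h1 h2 h3
      rw [h1, h2, Pi.smul_apply, h3]
      by_cases hx : x ∈ A <;> simp [hx]
    rw [this]
    exact Submodule.le_topologicalClosure _
      (Submodule.smul_mem _ _ (Submodule.subset_span ⟨A, hA, rfl⟩))
  · intro f g hf hg _ h1 h2
    exact Submodule.add_mem _ h1 h2
  · exact Submodule.isClosed_topologicalClosure _

variable {T : α → α}

lemma koopman_pow_coeFn (hT : MeasurePreserving T m m) (n : ℕ) (f : Lp ℝ 2 m) :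
    (koopman hT ^ n) f =ᵐ[m] f ∘ T^[n] := by
  induction n with
  | zero => simp
  | succ n ih =>
    rw [pow_succ', mul_apply_eq_comp]
    filter_upwards [koopman_coeFn hT ((koopman hT ^ n) f), hT.quasiMeasurePreserving.ae ih]
      with x h1 h2
    rw [h1, Function.comp_apply, h2, Function.comp_apply, Function.comp_apply,
      Function.iterate_succ_apply]

lemma koopman_pow_indLp (hT : MeasurePreserving T m m) (n : ℕ) {A : Set α}
    (hA : MeasurableSet A) :
    (koopman hT ^ n) (indLp m hA) = indLp m ((hT.iterate n).measurable hA) := by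
  apply Lp.ext
  filter_upwards [koopman_pow_coeFn hT n (indLp m hA), coeFn_indLp (m := m)
    ((hT.iterate n).measurable hA), (hT.iterate n).quasiMeasurePreserving.ae
      (coeFn_indLp (m := m) hA)] with x h1 h2 h3
  rw [h1, h2, Function.comp_apply, h3]
  rfl

/-- Correlations of all square integrable functions are null as soon as those of a total family
are. -/
lemma IsNullNotion.measureReal_of_dense {N : (ℕ → ℝ) → Prop} (hN : IsNullNotion N)
    (hT : MeasurePreserving T m m) {s : Set (Lp ℝ 2 m)}
    (hs : Dense (Submodule.span ℝ s : Set (Lp ℝ 2 m)))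
    (h : ∀ f ∈ s, ∀ g ∈ s, N fun j => inner ℝ ((koopman hT ^ j) f) g -
      inner ℝ (indLp m .univ) f * inner ℝ (indLp m .univ) g) {A B : Set α}
    (hA : MeasurableSet A) (hB : MeasurableSet B) :
    N fun j => m.real (T^[j] ⁻¹' A ∩ B) - m.real A * m.real B := by
  have h1 := hN.correlation_of_dense (norm_koopman_apply hT) norm_indLp_univ hs h
    (indLp m hA) (indLp m hB)
  simpa only [koopman_pow_indLp, inner_indLp, Set.univ_inter] using h1

lemma IsNullNotion.inner_of_measureReal {N : (ℕ → ℝ) → Prop} (hN : IsNullNotion N)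
    (hT : MeasurePreserving T m m)
    (h : ∀ A B : Set α, MeasurableSet A → MeasurableSet B →
      N fun j : ℕ => m.real (T^[j] ⁻¹' A ∩ B) - m.real A * m.real B) (f g : Lp ℝ 2 m) :
    N fun j => inner ℝ ((koopman hT ^ j) f) g -
      inner ℝ (indLp m .univ) f * inner ℝ (indLp m .univ) g := by
  refine hN.correlation_of_dense (norm_koopman_apply hT) norm_indLp_univ dense_span_indLp ?_ f g
  rintro _ ⟨A, hA, rfl⟩ _ ⟨B, hB, rfl⟩
  simpa only [koopman_pow_indLp, inner_indLp, Set.univ_inter] using h A B hA hB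

end Indicator

/-! ### Elementary estimates for the exponential -/

/-- Turns Cesàro nullity of bounded exponents into nullity of the correlations of exponential
vectors. -/
lemma Real.abs_exp_sub_one_le_mul {x C : ℝ} (hx : |x| ≤ C) :
    |Real.exp x - 1| ≤ Real.exp C * |x| := by
  have hC : 1 ≤ Real.exp C := Real.one_le_exp ((abs_nonneg x).trans hx)
  rcases le_total 0 x with h | h
  · rw [abs_of_nonneg h] at hx ⊢
    rw [abs_of_nonneg (by linarith [Real.add_one_le_exp x])]
    have h1 : 1 - x ≤ Real.exp (-x) := by linarith [Real.add_one_le_exp (-x)]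
    have h2 : Real.exp x * (1 - x) ≤ 1 := by
      calc Real.exp x * (1 - x) ≤ Real.exp x * Real.exp (-x) := by gcongr
        _ = 1 := by rw [← Real.exp_add, add_neg_cancel, Real.exp_zero]
    have h3 : Real.exp x * x ≤ Real.exp C * x := by gcongr
    linarith
  · rw [abs_of_nonpos h]
    rw [abs_of_nonpos (by linarith [Real.exp_le_one_iff.2 h])]
    have h1 := Real.add_one_le_exp x
    have h2 : 1 * -x ≤ Real.exp C * -x := by gcongr; linarith
    linarith

/-- The right side is $(2\sinh(x/2))^2$, and $|\sinh t| \ge |t|$. -/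
lemma Real.sq_le_exp_add_exp_neg_sub_two (x : ℝ) : x ^ 2 ≤ Real.exp x + Real.exp (-x) - 2 := by
  have h1 : Real.exp x + Real.exp (-x) - 2 = (2 * Real.sinh (x / 2)) ^ 2 := by
    have e1 : Real.exp x = Real.exp (x / 2) ^ 2 := by
      rw [← Real.exp_nat_mul]; congr 1; push_cast; ring
    have e2 : Real.exp (-x) = Real.exp (-(x / 2)) ^ 2 := by
      rw [← Real.exp_nat_mul]; congr 1; push_cast; ring
    have e3 : Real.exp (x / 2) * Real.exp (-(x / 2)) = 1 := by
      rw [← Real.exp_add, add_neg_cancel, Real.exp_zero]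
    rw [Real.sinh_eq, e1, e2]
    linear_combination 2 * e3
  rw [h1, sq_le_sq, abs_mul, abs_two]
  rcases le_total 0 x with h | h
  · have := Real.self_le_sinh_iff.2 (by linarith : 0 ≤ x / 2)
    rw [abs_of_nonneg h]
    linarith [le_abs_self (Real.sinh (x / 2))]
  · have := Real.sinh_le_self_iff.2 (by linarith : x / 2 ≤ 0)
    rw [abs_of_nonpos h]
    linarith [neg_le_abs (Real.sinh (x / 2))]

/-! ### The unitary part of a coisometry -/

section UnitaryPart

variable {H : Type*} [NormedAddCommGroup H] [InnerProductSpace ℝ H] [CompleteSpace H]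

lemma pow_adjoint_pow_apply {S : H →L[ℝ] H}
    (hS : S ∘L ContinuousLinearMap.adjoint S = ContinuousLinearMap.id ℝ H) (n : ℕ) (x : H) :
    (S ^ n) ((ContinuousLinearMap.adjoint S ^ n) x) = x := by
  refine ext_inner_right ℝ fun y => ?_
  rw [inner_pow_left, real_inner_comm]
  exact inner_map_map_of_norm (norm_pow_apply (norm_adjoint_apply_of_comp_adjoint hS) n) x y

/-- $p_n = S^{*n}S^nx$ is the projection of `x` onto the range of $S^{*n}$. These ranges decrease,
so by Pythagoras $p_n$ is Cauchy, and its limit lies in all of them. Moreover $\|p_n\| = \|S^nx\|$.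
-/
lemma tendsto_norm_pow_of_unitaryPart_eq_bot {S : H →L[ℝ] H}
    (hS : S ∘L ContinuousLinearMap.adjoint S = ContinuousLinearMap.id ℝ H)
    (hA : unitaryPart S = ⊥) (x : H) : Tendsto (fun n : ℕ => ‖(S ^ n) x‖) atTop (𝓝 0) := by
  set V := ContinuousLinearMap.adjoint S with hVdef
  have hV : ∀ x, ‖V x‖ = ‖x‖ := norm_adjoint_apply_of_comp_adjoint hS
  let p : ℕ → H := fun n => (V ^ n) ((S ^ n) x)
  let a : ℕ → ℝ := fun n => ‖(S ^ n) x‖ ^ 2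
  have hpn : ∀ n, ‖p n‖ = ‖(S ^ n) x‖ := fun n => norm_pow_apply hV n _
  have hpq : ∀ m n, m ≤ n → (V ^ m) ((S ^ m) (p n)) = p n := by
    intro m n hmn
    obtain ⟨k, rfl⟩ := Nat.exists_eq_add_of_le hmn
    simp only [p]
    rw [pow_add V, mul_apply_eq_comp, pow_adjoint_pow_apply hS]
  have hinner : ∀ m n, m ≤ n → inner ℝ (p m) (p n) = a n := by
    intro m n hmn
    have h1 : inner ℝ (p m) (p n) = inner ℝ ((S ^ m) x) ((S ^ m) (p n)) := by
      rw [← hpq m n hmn]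
      simp only [p]
      rw [inner_map_map_of_norm (norm_pow_apply hV m), pow_adjoint_pow_apply hS]
    rw [h1, inner_pow_left, ← hVdef, hpq m n hmn]
    simp only [p, a]
    rw [hVdef, ← inner_pow_left, real_inner_self_eq_norm_sq]
  have hdist : ∀ m n, m ≤ n → ‖p m - p n‖ ^ 2 = a m - a n := by
    intro m n hmn
    rw [norm_sub_sq_real, hinner m n hmn, hpn, hpn]
    simp only [a]; ring
  have hanti : Antitone a := fun m n hmn => by
    have := hdist m n hmn
    nlinarith [sq_nonneg ‖p m - p n‖]
  obtain ⟨r, hr⟩ : ∃ r, Tendsto a atTop (𝓝 r) :=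
    ⟨_, tendsto_atTop_ciInf hanti ⟨0, by rintro _ ⟨n, rfl⟩; positivity⟩⟩
  have hra : ∀ n, r ≤ a n := fun n => hanti.le_of_tendsto hr n
  have hle : ∀ N m n, N ≤ m → m ≤ n → ‖p m - p n‖ ≤ √(a N - r) := by
    intro N m n hN hmn
    refine Real.le_sqrt_of_sq_le ?_
    rw [hdist m n hmn]
    linarith [hanti hN, hra n]
  have hcauchy : CauchySeq p := by
    refine cauchySeq_of_le_tendsto_0 (fun N => √(a N - r)) ?_ ?_
    · intro m n N hm hn
      rcases le_total m n with h | h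
      · rw [dist_eq_norm]; exact hle N m n hm h
      · rw [dist_comm, dist_eq_norm]; exact hle N n m hn h
    · have : Tendsto (fun N => √(a N - r)) atTop (𝓝 √(r - r)) := (hr.sub_const r).sqrt
      simpa using this
  obtain ⟨y, hy⟩ := cauchySeq_tendsto_of_complete hcauchy
  have hyA : y ∈ unitaryPart S := by
    rw [unitaryPart, Submodule.mem_iInf]
    intro m
    refine ⟨(S ^ m) y, ?_⟩
    rw [ContinuousLinearMap.coe_coe, adjoint_pow]
    have h1 : Tendsto (fun n => (V ^ m) ((S ^ m) (p n))) atTop (𝓝 ((V ^ m) ((S ^ m) y))) :=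
      (((V ^ m).continuous.comp (S ^ m).continuous).tendsto y).comp hy
    refine tendsto_nhds_unique h1 (hy.congr' ?_)
    filter_upwards [eventually_ge_atTop m] with n hn
    exact (hpq m n hn).symm
  rw [hA, Submodule.mem_bot] at hyA
  rw [hyA] at hy
  simpa only [hpn, norm_zero] using hy.norm

end UnitaryPart

/-! ### Tail triviality -/

section Tail

variable {α : Type*} [m₀ : MeasurableSpace α]

/-- Occurring infinitely often ignores the first `N` indices, so the event is a preimage under
`T^[N]`. This gives exact tail events out of relations that hold only a.e. -/
lemma measurableSet_tailSigmaAlgebra_frequently {T : α → α} {B : ℕ → Set α}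
    (hB : ∀ n, MeasurableSet (B n)) (hT : Measurable T) :
    MeasurableSet[tailSigmaAlgebra T] {x | ∃ᶠ n in atTop, T^[n] x ∈ B n} := by
  rw [tailSigmaAlgebra, MeasurableSpace.measurableSet_iInf]
  intro N
  rw [MeasurableSpace.measurableSet_iInf]
  intro _
  refine ⟨{y | ∃ᶠ n in atTop, T^[n] y ∈ B (n + N)}, ?_, ?_⟩
  · have : {y | ∃ᶠ n in atTop, T^[n] y ∈ B (n + N)} =
        ⋂ a : ℕ, ⋃ b : ℕ, ⋃ _ : a ≤ b, T^[b] ⁻¹' B (b + N) := by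
      ext y
      simp [frequently_atTop]
    rw [this]
    exact .iInter fun a => .iUnion fun b => .iUnion fun _ => hT.iterate b (hB _)
  · ext x
    simp only [Set.preimage_ofPred_eq, Set.mem_ofPred_eq, ← Function.iterate_add_apply]
    conv_rhs => rw [← map_add_atTop_eq_nat N, Filter.frequently_map]

end Tail

/-! ### Mixing, ergodicity and tail triviality of `T` -/

section Main

variable {X H : Type*} [NormedAddCommGroup X] [NormedSpace ℝ X] [CompleteSpace X]
  [SecondCountableTopology X] [MeasurableSpace X] [BorelSpace X]
  [NormedAddCommGroup H] [InnerProductSpace ℝ H] [CompleteSpace H]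
  {ι : H →L[ℝ] X} {μ : Measure X} {S : H →L[ℝ] H} {T : X → X}

namespace IsAbstractWienerSpace

lemma expVec_zero_eq_indLp (hW : IsAbstractWienerSpace ι μ) [IsProbabilityMeasure μ] :
    hW.expVec 0 = indLp μ .univ := by
  apply Lp.ext
  filter_upwards [hW.coeFn_expVec_zero, coeFn_indLp (m := μ) .univ] with x h1 h2
  rw [h1, h2]; simp

lemma koopman_pow_expVec (hW : IsAbstractWienerSpace ι μ)
    (hS : S ∘L ContinuousLinearMap.adjoint S = ContinuousLinearMap.id ℝ H)
    (hT : IsAELinearExtension ι μ S T) (hmp : MeasurePreserving T μ μ) (n : ℕ) (h : H) :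
    (koopman hmp ^ n) (hW.expVec h) = hW.expVec ((ContinuousLinearMap.adjoint S ^ n) h) := by
  induction n with
  | zero => simp
  | succ n ih =>
    rw [pow_succ', mul_apply_eq_comp, ih, hW.koopman_expVec hS hT, pow_succ', mul_apply_eq_comp]

lemma koopman_pow_wienerMap (hW : IsAbstractWienerSpace ι μ)
    (hT : IsAELinearExtension ι μ S T) (hmp : MeasurePreserving T μ μ) (n : ℕ) (h : H) :
    (koopman hmp ^ n) (wienerMap ι μ h) =
      wienerMap ι μ ((ContinuousLinearMap.adjoint S ^ n) h) := by
  induction n with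
  | zero => simp
  | succ n ih =>
    rw [pow_succ', mul_apply_eq_comp, ih, hW.koopman_wienerMap hT, pow_succ', mul_apply_eq_comp]

lemma inner_koopman_pow_expVec (hW : IsAbstractWienerSpace ι μ)
    (hS : S ∘L ContinuousLinearMap.adjoint S = ContinuousLinearMap.id ℝ H)
    (hT : IsAELinearExtension ι μ S T) (hmp : MeasurePreserving T μ μ) (n : ℕ) (h k : H) :
    inner ℝ ((koopman hmp ^ n) (hW.expVec h)) (hW.expVec k) =
      Real.exp (inner ℝ ((S ^ n) k) h) := by
  rw [hW.koopman_pow_expVec hS hT, hW.inner_expVec, inner_pow_left S n k h]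

lemma corr_expVec (hW : IsAbstractWienerSpace ι μ) [IsProbabilityMeasure μ]
    (hS : S ∘L ContinuousLinearMap.adjoint S = ContinuousLinearMap.id ℝ H)
    (hT : IsAELinearExtension ι μ S T) (hmp : MeasurePreserving T μ μ) (n : ℕ) (h k : H) :
    inner ℝ ((koopman hmp ^ n) (hW.expVec h)) (hW.expVec k) -
      inner ℝ (indLp μ .univ) (hW.expVec h) * inner ℝ (indLp μ .univ) (hW.expVec k) =
      Real.exp (inner ℝ ((S ^ n) k) h) - 1 := by
  rw [hW.inner_koopman_pow_expVec hS hT, ← hW.expVec_zero_eq_indLp, hW.inner_expVec,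
    hW.inner_expVec]
  simp

/-- Mixing of the map `T`, in the sense of a notion of null sequence, is mixing on exponential
vectors. -/
lemma isNull_measureReal_iff (hW : IsAbstractWienerSpace ι μ)
    (hS : S ∘L ContinuousLinearMap.adjoint S = ContinuousLinearMap.id ℝ H)
    (hT : IsAELinearExtension ι μ S T) {N : (ℕ → ℝ) → Prop} (hN : IsNullNotion N) :
    (∀ A B : Set X, MeasurableSet A → MeasurableSet B →
      N fun j => μ.real (T^[j] ⁻¹' A ∩ B) - μ.real A * μ.real B) ↔
    ∀ x y : H, N fun j => Real.exp (inner ℝ ((S ^ j) x) y) - 1 := by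
  have := hW.isGaussian
  have hmp := hW.measurePreserving hS hT
  constructor
  · intro h x y
    simpa only [hW.corr_expVec hS hT] using
      hN.inner_of_measureReal hmp h (hW.expVec y) (hW.expVec x)
  · intro h A B hA hB
    refine hN.measureReal_of_dense hmp hW.dense_span_expVec ?_ hA hB
    rintro _ ⟨y, rfl⟩ _ ⟨x, rfl⟩
    simpa only [hW.corr_expVec hS hT] using h x y

lemma stronglyMixing_iff (hW : IsAbstractWienerSpace ι μ)
    (hS : S ∘L ContinuousLinearMap.adjoint S = ContinuousLinearMap.id ℝ H)
    (hT : IsAELinearExtension ι μ S T) :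
    StronglyMixing T μ ↔
      ∀ x y : H, Tendsto (fun n : ℕ => inner ℝ ((S ^ n) x) y) atTop (𝓝 0) := by
  have key := hW.isNull_measureReal_iff hS hT isNullNotion_tendsto
  have h1 : StronglyMixing T μ ↔ ∀ A B : Set X, MeasurableSet A → MeasurableSet B →
      Tendsto (fun j : ℕ => μ.real (T^[j] ⁻¹' A ∩ B) - μ.real A * μ.real B) atTop (𝓝 0) := by
    constructor
    · intro h A B hA hB
      simpa using (h.mixing A B hA hB).sub_const (μ.real A * μ.real B)
    · intro h
      refine ⟨hW.measurePreserving hS hT, fun A B hA hB => ?_⟩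
      simpa using (h A B hA hB).add_const (μ.real A * μ.real B)
  rw [h1, key]
  refine forall_congr' fun x => forall_congr' fun y => ⟨fun h => ?_, fun h => ?_⟩
  · have h2 : Tendsto (fun n : ℕ => Real.exp (inner ℝ ((S ^ n) x) y)) atTop (𝓝 1) := by
      simpa using h.add_const 1
    have h3 := h2.log one_ne_zero
    simpa only [Real.log_exp, Real.log_one] using h3
  · have h2 := h.rexp.sub_const 1
    simpa only [Real.exp_zero, sub_self] using h2

lemma abs_inner_pow_le
    (hS : S ∘L ContinuousLinearMap.adjoint S = ContinuousLinearMap.id ℝ H) (x y : H) (j : ℕ) :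
    |inner ℝ ((S ^ j) x) y| ≤ ‖x‖ * ‖y‖ := by
  rw [inner_pow_left, mul_comm]
  have := abs_real_inner_le_norm ((ContinuousLinearMap.adjoint S ^ j) y) x
  rwa [norm_pow_apply (norm_adjoint_apply_of_comp_adjoint hS)] at this

lemma weaklyMixing_of_cesaroNull (hW : IsAbstractWienerSpace ι μ)
    (hS : S ∘L ContinuousLinearMap.adjoint S = ContinuousLinearMap.id ℝ H)
    (hT : IsAELinearExtension ι μ S T)
    (h : ∀ x y : H, CesaroNull fun j => inner ℝ ((S ^ j) x) y) : WeaklyMixing T μ := by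
  refine ⟨hW.measurePreserving hS hT, ?_⟩
  refine (hW.isNull_measureReal_iff hS hT isNullNotion_cesaroNull).2 fun x y => ?_
  exact (h x y).of_le _ fun j => Real.abs_exp_sub_one_le_mul (abs_inner_pow_le hS x y j)

/-- By ergodicity the averages of $U^jE(y)$, with $U$ composition with `T`, tend to a constant.
Pairing with $E(x)$ and $E(-x)$ controls the averages of $e^{t} + e^{-t} - 2 \ge t^2$ for $t =
\langle S^jx,y\rangle$. -/
lemma cesaroNull_of_ergodic (hW : IsAbstractWienerSpace ι μ)
    (hS : S ∘L ContinuousLinearMap.adjoint S = ContinuousLinearMap.id ℝ H)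
    (hT : IsAELinearExtension ι μ S T) (hE : Ergodic T μ) (x y : H) :
    CesaroNull fun j => inner ℝ ((S ^ j) x) y := by
  have := hW.isGaussian
  have hmp := hE.toMeasurePreserving
  have key : ∀ y x : H,
      Tendsto (cesaroMean fun j => Real.exp (inner ℝ ((S ^ j) x) y)) atTop (𝓝 1) := by
    intro y
    obtain ⟨g, hg, hlim⟩ := exists_fixed_tendsto_cesaroMean_pow (koopman hmp)
      (ContinuousLinearMap.opNorm_le_bound _ zero_le_one fun f => by
        rw [norm_koopman_apply, one_mul]) (hW.expVec y)
    have hcomp : g ∘ T =ᵐ[μ] g := by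
      have := koopman_coeFn hmp g
      rw [hg] at this
      exact this.symm
    obtain ⟨c, hc⟩ := hE.ae_eq_const_of_ae_eq_comp_ae (Lp.aestronglyMeasurable g) hcomp
    have hgc : g = c • hW.expVec 0 := by
      apply Lp.ext
      filter_upwards [hc, hW.coeFn_expVec_zero, Lp.coeFn_smul c (hW.expVec 0)] with x h1 h2 h3
      rw [h1, h3, Pi.smul_apply, h2]; simp
    have hlim' : ∀ x : H,
        Tendsto (cesaroMean fun j => Real.exp (inner ℝ ((S ^ j) x) y)) atTop (𝓝 c) := by
      intro x
      have h1 := ((innerSL ℝ (hW.expVec x)).continuous.tendsto g).comp hlim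
      have h2 : innerSL ℝ (hW.expVec x) g = c := by
        rw [innerSL_apply_apply, hgc, real_inner_smul_right, hW.inner_expVec]; simp
      rw [h2] at h1
      refine h1.congr fun n => ?_
      rw [Function.comp_apply]
      erw [map_cesaroMean (innerSL ℝ (hW.expVec x) : Lp ℝ 2 μ →L[ℝ] ℝ)]
      simp only [innerSL_apply_apply, real_inner_comm _ (hW.expVec x)]
      simp only [hW.inner_koopman_pow_expVec hS hT hmp]
    -- The limit does not depend on the paired vector, and at `0` every exponential equals 1.
    have hc1 : c = 1 := by
      refine tendsto_nhds_unique (hlim' 0) (tendsto_const_nhds.congr' ?_)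
      filter_upwards [eventually_ne_atTop 0] with n hn
      simp [cesaroMean_const _ hn]
    rw [← hc1]; exact hlim'
  apply cesaroNull_of_sq
  have h2 : Tendsto (cesaroMean fun j => Real.exp (inner ℝ ((S ^ j) x) y) +
      (Real.exp (inner ℝ ((S ^ j) (-x)) y) + (-2))) atTop (𝓝 0) := by
    have h3 : Tendsto (cesaroMean fun _ => (-2 : ℝ)) atTop (𝓝 (-2)) := by
      refine tendsto_const_nhds.congr' ?_
      filter_upwards [eventually_ne_atTop 0] with n hn
      rw [cesaroMean_const _ hn]
    have h4 := (key y x).add ((key y (-x)).add h3)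
    rw [show (1 : ℝ) + (1 + -2) = 0 by norm_num] at h4
    refine h4.congr fun n => ?_
    rw [cesaroMean_add, cesaroMean_add]
  refine squeeze_zero (fun n => cesaroMean_nonneg (fun j => sq_nonneg _) n)
    (fun n => cesaroMean_mono (fun j => ?_) n) h2
  rw [map_neg, inner_neg_left]
  linarith [Real.sq_le_exp_add_exp_neg_sub_two (inner ℝ ((S ^ j) x) y)]

end IsAbstractWienerSpace

/-- For an invariant set the correlations with itself are constantly $m(s) - m(s)^2$, and a null
constant is zero. -/
lemma WeaklyMixing.ergodic {α : Type*} [MeasurableSpace α] {m : Measure α}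
    [IsProbabilityMeasure m] {T : α → α} (h : WeaklyMixing T m) : Ergodic T m := by
  refine { h.toMeasurePreserving with aeconst_set := fun s hs hTs => ?_ }
  have hpre : ∀ j : ℕ, T^[j] ⁻¹' s = s := fun j => by
    induction j with
    | zero => rfl
    | succ j ih => rw [Function.iterate_succ, Set.preimage_comp, ih, hTs]
  have h1 := h.mixing s s hs hs
  simp only [hpre, Set.inter_self] at h1
  have h2 : m.real s - m.real s * m.real s = 0 := by
    by_contra hne
    exact not_cesaroNull_const hne h1
  have h3 : m.real s * (1 - m.real s) = 0 := by linarith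
  rw [Filter.eventuallyConst_set']
  rcases mul_eq_zero.1 h3 with h4 | h4
  · left
    exact ae_eq_empty.2 ((measureReal_eq_zero_iff).1 h4)
  · right
    rw [ae_eq_univ, prob_compl_eq_zero_iff hs, ← ENNReal.ofReal_toReal (measure_ne_top m s)]
    change ENNReal.ofReal (m.real s) = 1
    rw [show m.real s = 1 by linarith, ENNReal.ofReal_one]

namespace IsAbstractWienerSpace

/-- A tail indicator is $U^n1_B$ for every `n`, with `B` depending on `n`. Its pairing with $E(k)$
is that of $1_B$ with $E(S^nk)$, which is close to $E(0) = 1$ uniformly in `B`. So it pairs with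
each $E(k)$ as a constant does, and by totality it is constant. -/
lemma isZeroOne_tail_of_tendsto (hW : IsAbstractWienerSpace ι μ)
    (hS : S ∘L ContinuousLinearMap.adjoint S = ContinuousLinearMap.id ℝ H)
    (hT : IsAELinearExtension ι μ S T)
    (h : ∀ x : H, Tendsto (fun n : ℕ => ‖(S ^ n) x‖) atTop (𝓝 0)) :
    IsZeroOneSigmaAlgebra μ (tailSigmaAlgebra T) := by
  have := hW.isGaussian
  have hmp := hW.measurePreserving hS hT
  intro s hs
  have hpre : ∀ n : ℕ, 1 ≤ n → ∃ B, MeasurableSet B ∧ T^[n] ⁻¹' B = s := by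
    intro n hn
    rw [tailSigmaAlgebra, MeasurableSpace.measurableSet_iInf] at hs
    have := hs n
    rw [MeasurableSpace.measurableSet_iInf] at this
    exact this hn
  have hsm : MeasurableSet s := by
    obtain ⟨B, hB, hBs⟩ := hpre 1 le_rfl
    rw [← hBs]
    exact (hmp.iterate 1).measurable hB
  -- The adjoint of the Koopman power sends $E(k)$ to $E(S^nk)$, checked on exponential vectors and
  -- extended by density.
  have hadj : ∀ (n : ℕ) (f : Lp ℝ 2 μ) (k : H),
      inner ℝ (hW.expVec k) ((koopman hmp ^ n) f) = inner ℝ (hW.expVec ((S ^ n) k)) f := by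
    intro n f k
    have hclosed : IsClosed {f : Lp ℝ 2 μ |
        inner ℝ (hW.expVec k) ((koopman hmp ^ n) f) = inner ℝ (hW.expVec ((S ^ n) k)) f} :=
      isClosed_eq (by fun_prop) (by fun_prop)
    have hspan : (Submodule.span ℝ (Set.range hW.expVec) : Set (Lp ℝ 2 μ)) ⊆ {f : Lp ℝ 2 μ |
        inner ℝ (hW.expVec k) ((koopman hmp ^ n) f) = inner ℝ (hW.expVec ((S ^ n) k)) f} := by
      intro f hf
      induction hf using Submodule.span_induction with
      | mem f hf =>
        obtain ⟨y, rfl⟩ := hf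
        change inner ℝ _ _ = inner ℝ _ _
        rw [real_inner_comm, hW.inner_koopman_pow_expVec hS hT, hW.inner_expVec]
      | zero => simp
      | add f g _ _ hf hg =>
        change inner ℝ _ _ = inner ℝ _ _
        rw [map_add, inner_add_right, inner_add_right, hf, hg]
      | smul c f _ hf =>
        change inner ℝ _ _ = inner ℝ _ _
        rw [map_smul, real_inner_smul_right, real_inner_smul_right, hf]
    exact hclosed.closure_subset_iff.2 hspan (hW.dense_span_expVec f)
  have hconv : ∀ k : H, Tendsto (fun n : ℕ => ‖hW.expVec ((S ^ n) k) - hW.expVec 0‖) atTop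
      (𝓝 0) := by
    intro k
    have h1 : ∀ n : ℕ, ‖hW.expVec ((S ^ n) k) - hW.expVec 0‖ =
        √(Real.exp (‖(S ^ n) k‖ ^ 2) - 1) := fun n => by
      rw [← Real.sqrt_sq (norm_nonneg (hW.expVec ((S ^ n) k) - hW.expVec 0)), norm_sub_sq_real,
        ← real_inner_self_eq_norm_sq, ← real_inner_self_eq_norm_sq, hW.inner_expVec,
        hW.inner_expVec, hW.inner_expVec, real_inner_self_eq_norm_sq]
      congr 1
      simp only [inner_zero_right, Real.exp_zero]
      ring
    simp only [h1]
    have h2 := ((((h k).pow 2).rexp).sub_const 1).sqrt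
    simpa using h2
  have hproj : ∀ k : H, inner ℝ (hW.expVec k) (indLp μ hsm) = μ.real s := by
    intro k
    have hz : Tendsto (fun n : ℕ => ‖inner ℝ (hW.expVec k) (indLp μ hsm) - μ.real s‖) atTop
        (𝓝 0) := by
      refine squeeze_zero' (.of_forall fun n => norm_nonneg _) ?_ (hconv k)
      filter_upwards [eventually_ge_atTop 1] with n hn
      obtain ⟨B, hB, rfl⟩ := hpre n hn
      have e1 : indLp μ hsm = (koopman hmp ^ n) (indLp μ hB) := (koopman_pow_indLp hmp n hB).symm
      have e2 : μ.real (T^[n] ⁻¹' B) = inner ℝ (hW.expVec 0) (indLp μ hB) := by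
        rw [hW.expVec_zero_eq_indLp, inner_indLp, Set.univ_inter, measureReal_def,
          (hmp.iterate n).measure_preimage hB.nullMeasurableSet, measureReal_def]
      rw [e1, hadj, e2, ← inner_sub_left]
      refine (norm_inner_le_norm _ _).trans ?_
      have e3 : ‖indLp μ hB‖ ≤ 1 := by
        have h4 : ‖indLp μ hB‖ ^ 2 ≤ 1 ^ 2 := by
          rw [← real_inner_self_eq_norm_sq, inner_indLp, one_pow]
          exact measureReal_le_one
        exact (sq_le_sq₀ (norm_nonneg _) zero_le_one).1 h4
      exact mul_le_of_le_one_right (norm_nonneg _) e3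
    have := tendsto_nhds_unique hz tendsto_const_nhds
    rw [eq_comm, norm_eq_zero] at this
    linarith
  have hconst : indLp μ hsm - μ.real s • hW.expVec 0 = 0 := by
    refine hW.eq_zero_of_inner_expVec_eq_zero fun k => ?_
    rw [inner_sub_right, hproj, real_inner_smul_right, hW.inner_expVec]
    simp
  have hself : μ.real s = μ.real s * μ.real s := by
    have h1 := inner_indLp (m := μ) hsm hsm
    rw [Set.inter_self] at h1
    conv_lhs at h1 => rw [sub_eq_zero.1 hconst, real_inner_smul_left, ← sub_eq_zero.1 hconst, hproj]
    exact h1.symm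
  have h3 : μ.real s * (1 - μ.real s) = 0 := by linarith
  rcases mul_eq_zero.1 h3 with h4 | h4
  · left
    exact (measureReal_eq_zero_iff).1 h4
  · right
    rw [← ENNReal.ofReal_toReal (measure_ne_top μ s)]
    change ENNReal.ofReal (μ.real s) = 1
    rw [show μ.real s = 1 by linarith, ENNReal.ofReal_one]

lemma measure_wienerMap_pos_eq (hW : IsAbstractWienerSpace ι μ) (x : H) :
    μ {y | 0 < wienerMap ι μ x y} = μ {y | wienerMap ι μ x y < 0} := by
  have hm : Measurable (wienerMap ι μ x) := (Lp.stronglyMeasurable _).measurable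
  have h1 : μ {y | 0 < wienerMap ι μ x y} = gaussianReal 0 (‖x‖₊ ^ 2) (Set.Ioi 0) := by
    rw [← hW.map_wienerMap, Measure.map_apply hm measurableSet_Ioi]; rfl
  have h2 : μ {y | wienerMap ι μ x y < 0} = gaussianReal 0 (‖x‖₊ ^ 2) (Set.Iio 0) := by
    rw [← hW.map_wienerMap, Measure.map_apply hm measurableSet_Iio]; rfl
  rw [h1, h2]
  conv_lhs => rw [← neg_zero, ← gaussianReal_map_neg]
  rw [Measure.map_apply measurable_neg measurableSet_Ioi]
  congr 1
  ext y
  simp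

/-- If $x = S^{*n}y_n$ for all `n`, then $Wx = Wy_n\circ T^n$ a.e., so $\{Wx>0\}$ agrees a.e. with
the tail event that $Wy_n(T^nz) > 0$ infinitely often. It has the measure of $\{Wx<0\}$, so the
zero-one law forces $Wx = 0$. -/
lemma unitaryPart_eq_bot_of_isZeroOne_tail (hW : IsAbstractWienerSpace ι μ)
    (hS : S ∘L ContinuousLinearMap.adjoint S = ContinuousLinearMap.id ℝ H)
    (hT : IsAELinearExtension ι μ S T) (h : IsZeroOneSigmaAlgebra μ (tailSigmaAlgebra T)) :
    unitaryPart S = ⊥ := by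
  have := hW.isGaussian
  have hmp := hW.measurePreserving hS hT
  rw [Submodule.eq_bot_iff]
  intro x hx
  rw [unitaryPart, Submodule.mem_iInf] at hx
  have hx' : ∀ n : ℕ, ∃ y, (ContinuousLinearMap.adjoint S ^ n) y = x := fun n => by
    obtain ⟨y, hy⟩ := hx n
    exact ⟨y, by rw [← adjoint_pow]; exact hy⟩
  choose y hy using hx'
  have hm : ∀ z : H, Measurable (wienerMap ι μ z) := fun z => (Lp.stronglyMeasurable _).measurable
  let B : ℕ → Set X := fun n => {z | 0 < wienerMap ι μ (y n) z}
  have hB : ∀ n, MeasurableSet (B n) := fun n => hm (y n) measurableSet_Ioi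
  have hae : ∀ᵐ z ∂μ, ∀ n : ℕ, wienerMap ι μ (y n) (T^[n] z) = wienerMap ι μ x z := by
    refine ae_all_iff.2 fun n => ?_
    have h1 := koopman_pow_coeFn hmp n (wienerMap ι μ (y n))
    rw [hW.koopman_pow_wienerMap hT, hy] at h1
    filter_upwards [h1] with z hz
    rw [hz]; rfl
  have hs : μ {z | ∃ᶠ n in atTop, T^[n] z ∈ B n} = μ {z | 0 < wienerMap ι μ x z} := by
    refine measure_congr ?_
    filter_upwards [hae] with z hz
    change (∃ᶠ n in atTop, 0 < wienerMap ι μ (y n) (T^[n] z)) = (0 < wienerMap ι μ x z)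
    simp only [hz, frequently_const]
  have h01 := h _ (measurableSet_tailSigmaAlgebra_frequently hB hT.measurable)
  rw [hs] at h01
  have hsymm := hW.measure_wienerMap_pos_eq x
  have hdisj : μ {z | 0 < wienerMap ι μ x z} + μ {z | wienerMap ι μ x z < 0} ≤ 1 := by
    rw [← measure_union _ (show MeasurableSet {z | wienerMap ι μ x z < 0} from
      hm x measurableSet_Iio)]
    · exact prob_le_one
    · rw [Set.disjoint_left]
      intro z h1 h2
      exact lt_asymm (show 0 < wienerMap ι μ x z from h1) h2
  have h0 : μ {z | 0 < wienerMap ι μ x z} = 0 := by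
    rcases h01 with h1 | h1
    · exact h1
    · rw [← hsymm, h1] at hdisj
      norm_num at hdisj
  have hzero : wienerMap ι μ x = 0 := by
    apply Lp.ext
    have h1 : ∀ᵐ z ∂μ, ¬ 0 < wienerMap ι μ x z := by rw [ae_iff]; simpa using h0
    have h2 : ∀ᵐ z ∂μ, ¬ wienerMap ι μ x z < 0 := by rw [ae_iff]; simpa using hsymm ▸ h0
    filter_upwards [h1, h2, Lp.coeFn_zero ℝ 2 μ] with z h3 h4 h5
    rw [h5]
    exact le_antisymm (not_lt.1 h3) (not_lt.1 h4)
  rw [← norm_eq_zero, ← hW.norm_wienerMap, hzero, norm_zero]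

end IsAbstractWienerSpace

end Main

theorem propositionA3 {X H : Type*}
    [NormedAddCommGroup X] [NormedSpace ℝ X] [CompleteSpace X] [SecondCountableTopology X]
    [MeasurableSpace X] [BorelSpace X]
    [NormedAddCommGroup H] [InnerProductSpace ℝ H] [CompleteSpace H]
    (ι : H →L[ℝ] X) (μ : Measure X) (hW : IsAbstractWienerSpace ι μ)
    (S : H →L[ℝ] H) (hS : S ∘L ContinuousLinearMap.adjoint S = ContinuousLinearMap.id ℝ H)
    (T : X → X) (hT : IsAELinearExtension ι μ S T) :
    (IsZeroOneSigmaAlgebra μ (tailSigmaAlgebra T) ↔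
      ∀ x : H, Tendsto (fun n : ℕ => ‖(S ^ n) x‖) atTop (𝓝 0)) ∧
    (StronglyMixing T μ ↔
      ∀ x y : H, Tendsto (fun n : ℕ => inner ℝ ((S ^ n) x) y) atTop (𝓝 0)) ∧
    List.TFAE [
      Ergodic T μ,
      ∀ (x y : H) (k : ℕ), 1 ≤ k →
        Tendsto (fun n : ℕ => (1 / (n : ℝ)) * ∑ j ∈ Finset.Icc 1 n, (inner ℝ ((S ^ j) x) y) ^ k)
          atTop (𝓝 0),
      ∀ x y : H,
        Tendsto (fun n : ℕ => (1 / (n : ℝ)) * ∑ j ∈ Finset.Icc 1 n, |inner ℝ ((S ^ j) x) y|)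
          atTop (𝓝 0),
      WeaklyMixing T μ,
      ∀ M : Submodule ℝ H, ¬ IsRotationPlane S M ∧ ¬ IsOrthogonalLine S M,
      ∀ x ∈ unitaryPart S, ∃ ν : Measure Circle, IsSpectralMeasure S x ν ∧ ∀ z : Circle, ν {z} = 0] := by
  have := hW.isGaussian
  refine ⟨⟨fun h x => ?_, hW.isZeroOne_tail_of_tendsto hS hT⟩, hW.stronglyMixing_iff hS hT, ?_⟩
  · exact tendsto_norm_pow_of_unitaryPart_eq_bot hS
      (hW.unitaryPart_eq_bot_of_isZeroOne_tail hS hT h) x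
  tfae_have 1 → 3 := fun h x y => hW.cesaroNull_of_ergodic hS hT h x y
  tfae_have 3 → 2 := by
    intro h x y k hk
    obtain ⟨k, rfl⟩ := Nat.exists_eq_add_of_le' hk
    refine CesaroNull.tendsto_cesaroMean (c := fun j => (inner ℝ ((S ^ j) x) y) ^ (k + 1))
      (CesaroNull.of_le (d := fun j => inner ℝ ((S ^ j) x) y) (h x y) ((‖x‖ * ‖y‖) ^ k)
        fun j => ?_)
    rw [abs_pow, pow_succ]
    gcongr
    exact IsAbstractWienerSpace.abs_inner_pow_le hS x y j
  -- The exponent 2 alone suffices.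
  tfae_have 2 → 3 := fun h x y => cesaroNull_of_sq (h x y 2 one_le_two)
  tfae_have 3 → 4 := fun h => hW.weaklyMixing_of_cesaroNull hS hT h
  tfae_have 4 → 1 := fun h => h.ergodic
  tfae_have 3 → 6 := by
    intro h x _
    obtain ⟨ν, hν⟩ := exists_isSpectralMeasure hS x
    exact ⟨ν, hν, hν.atomless_of_cesaroNull (h x x)⟩
  tfae_have 6 → 5 := fun h M => not_isRotationPlane_of_atomless hS h M
  tfae_have 5 → 3 := fun h x y => cesaroNull_inner_of_forall_not_isRotationPlane hS h x y
  tfae_finish
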